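/- Let $\Lambda,\tilde k,\mu,\tilde a,a_1>0$, put $K=\tilde k/(6\pi\mu\tilde a)$, let $L_0(t)=L(1+\tilde\varepsilon\cos(\omega t))$ with $L,\omega>0$, $\tilde\varepsilon\in[0,1)$, and write $\|\cdot\|$ for the norm of $L^2(0,\Lambda)$. Let $\mathcal V=\{u\in H^1(0,\Lambda): u(\Lambda)=0\}$ and, for $u,v\in\mathcal V$, $$\kappa(u,v)=\Lambda^2K\int_0^\Lambda \partial_yu\,\partial_yv\,dy+\frac{\Lambda K\tilde a}{2a_1}u(0)v(0).$$ Continuous model. Let $\ell_0\in H^2(0,\Lambda)$ and let $\ell$ be a solution with initial datum $\ell_0$ of the variational problem: for every $T>0$, $\ell\in L^\infty(0,T;L^2(0,\Lambda))\cap L^2(0,T;\mathcal V)$, $\ell(t)\to\ell_0=\ell(0)$ in $L^2(0,\Lambda)$ as $t\to0^+$, and for all $t\in(0,T)$ one has $\ell(t)\in\mathcal V$ and, for all $v\in\mathcal V$, $$\frac{d}{dt}\int_0^\Lambda \ell(t)\,v\,dy+\kappa(\ell(t),v)=-\frac{\Lambda}{2}\dot L_0(t)\,v(0).$$ $N$-spring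 model. For an integer $N\ge1$ let $h=\Lambda/N$, $y_j=(j-1)h$ for $1\le j\le N+1$, let $\mathcal V_h$ be the space of continuous functions on $[0,\Lambda]$ that are affine on each $[y_j,y_{j+1}]$ and vanish at $\Lambda$, and let $\Phi_1,\dots,\Phi_N$ be its hat functions, $\Phi_j(y_k)=\delta_{jk}$. Let $\ell_{0,h}\in\mathcal V_h$, and let $\ell_h(t)\in\mathcal V_h$ be such that $L_h(t)=(\ell_h(y_1,t),\dots,\ell_h(y_N,t))^T$ is continuous on $[0,\infty)$, $\ell_h(0)=\ell_{0,h}$, and for all $t>0$ $$\frac{d}{dt}\big(h\,L_h(t)\big)+K_hL_h(t)=\Big(-\frac{\Lambda}{2}\dot L_0(t),0,\dots,0\Big)^T,\qquad (K_h)_{ij}=\kappa(\Phi_i,\Phi_j).$$ Then there is a constant $C>0$, depending only on $\Lambda,\tilde k,\mu,\tilde a,a_1$ (in particular not on $h$, $t$, $L_0$, $\ell$ or $\ell_h$), such that for all $t\ge0$ $$\|\partial_y(\ell_h-\ell)(t)\|\le Ch\big(\|\partial_{yy}\ell_0\|+\|\partial_{yy}\ell(t)\|\big)+C\|\partial_y(\ell_{0,h}-\ell_0)\|+C\sqrt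 h\Big(\int_0^t\|\partial_{yt}\ell\|^2\,ds\Big)^{1/2}.$$ Here the derivatives are weak derivatives, and $\|\partial_{yy}\ell(t)\|$, respectively $\int_0^t\|\partial_{yt}\ell\|^2ds$, is read as $+\infty$ if $\ell(t)\notin H^2(0,\Lambda)$, respectively if the distribution $\partial_{yt}\ell$ on $(0,t)\times(0,\Lambda)$ is not a square integrable function. -/

import Mathlib

open MeasureTheory Set Filter Topology
open scoped ENNReal NNReal ContDiff

noncomputable section

namespace ElasticSwimmer

/-! ### Physical parameters -/

/-- Parameters of the passive tail: total rest length `Λ`, rescaled stiffness `kt`, viscosity `mu`,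
rescaled radius `ta` of the tail spheres and radius `a₁` of the two front spheres. -/
structure Tail where
  Λ : ℝ
  kt : ℝ
  mu : ℝ
  ta : ℝ
  a₁ : ℝ
  Λ_pos : 0 < Λ
  kt_pos : 0 < kt
  mu_pos : 0 < mu
  ta_pos : 0 < ta
  a₁_pos : 0 < a₁

/-- The constant `K = k̃ / (6 π μ ã)`. -/
def Tail.K (P : Tail) : ℝ := P.kt / (6 * Real.pi * P.mu * P.ta)

/-- The prescribed motion of the active arm: rest length `L`, relative amplitude `ε ∈ [0, 1)` and
angular frequency `ω = freq`. -/
structure Stroke where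
  L : ℝ
  ε : ℝ
  freq : ℝ
  L_pos : 0 < L
  ε_nonneg : 0 ≤ ε
  ε_lt_one : ε < 1
  freq_pos : 0 < freq

/-- The length of the active arm, `L₀(t) = L (1 + ε cos (ω t))`. -/
def Stroke.L₀ (S : Stroke) (t : ℝ) : ℝ := S.L * (1 + S.ε * Real.cos (S.freq * t))

/-! ### Function spaces on the interval `(0, Λ)` -/

/-- The `L²(0, Λ)` norm, with values in `[0, ∞]`. -/
def normL2 (Λ : ℝ) (u : ℝ → ℝ) : ℝ≥0∞ := eLpNorm u 2 (volume.restrict (Ioo 0 Λ))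

/-- `u ∈ H¹(0, Λ)`, through its continuous representative on `[0, Λ]`: `u` is absolutely continuous
on `[0, Λ]` and its (almost everywhere defined) derivative is square integrable. The weak
derivative `∂_y u` is then `deriv u`. -/
def MemH1 (Λ : ℝ) (u : ℝ → ℝ) : Prop :=
  AbsolutelyContinuousOnInterval u 0 Λ ∧ MemLp (deriv u) 2 (volume.restrict (Ioo 0 Λ))

/-- `u ∈ H²(0, Λ)`: `u ∈ H¹(0, Λ)` and `∂_y u` has a representative in `H¹(0, Λ)`. -/
def MemH2 (Λ : ℝ) (u : ℝ → ℝ) : Prop :=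
  MemH1 Λ u ∧ ∃ w : ℝ → ℝ, MemH1 Λ w ∧ ∀ᵐ y ∂(volume.restrict (Ioo 0 Λ)), deriv u y = w y

/-- The space `𝒱` of the functions `u ∈ H¹(0, Λ)` with `u(Λ) = 0`. -/
def MemV (Λ : ℝ) (u : ℝ → ℝ) : Prop := MemH1 Λ u ∧ u Λ = 0

open Classical in
/-- The norm `‖∂_yy u‖` in `L²(0, Λ)`, equal to `∞` if `u` is not in `H²(0, Λ)`. (A function
in `H²(0, Λ)` is continuously differentiable, so that the iterated derivative below is its weak
second derivative.) -/
def normDyy (Λ : ℝ) (u : ℝ → ℝ) : ℝ≥0∞ :=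
  if MemH2 Λ u then normL2 Λ (deriv (deriv u)) else ∞

/-- `g` is the weak mixed derivative `∂_yt ℓ` on `(0, T) × (0, Λ)`, that is, the mixed derivative
in the sense of distributions, represented by a locally integrable function. -/
def HasWeakDyt (Λ T : ℝ) (l g : ℝ → ℝ → ℝ) : Prop :=
  LocallyIntegrableOn (fun p : ℝ × ℝ => g p.1 p.2) (Ioo 0 T ×ˢ Ioo 0 Λ) ∧
  ∀ φ : ℝ × ℝ → ℝ, ContDiff ℝ ∞ φ → HasCompactSupport φ → tsupport φ ⊆ Ioo 0 T ×ˢ Ioo 0 Λ →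
    ∫ p in Ioo 0 T ×ˢ Ioo 0 Λ,
        l p.1 p.2 * deriv (fun s => deriv (fun y => φ (s, y)) p.2) p.1 =
      ∫ p in Ioo 0 T ×ˢ Ioo 0 Λ, g p.1 p.2 * φ p

/-- The quantity `∫₀ᵗ ‖∂_yt ℓ‖² ds` in `[0, ∞]`, equal to `∞` if `∂_yt ℓ` is not represented by a
function. (The weak derivative is unique up to null sets: the infimum is over its
representatives.) -/
def intSqDyt (Λ t : ℝ) (l : ℝ → ℝ → ℝ) : ℝ≥0∞ :=
  ⨅ (g : ℝ → ℝ → ℝ) (_ : HasWeakDyt Λ t l g), ∫⁻ s in Ioo 0 t, normL2 Λ (g s) ^ 2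

/-! ### The continuous model -/

/-- The bilinear form `κ(u, v) = Λ² K ∫ ∂_y u ∂_y v + (Λ K ã / (2 a₁)) u(0) v(0)`. -/
def kappa (P : Tail) (u v : ℝ → ℝ) : ℝ :=
  P.Λ ^ 2 * P.K * (∫ y in (0 : ℝ)..P.Λ, deriv u y * deriv v y) +
    P.Λ * P.K * P.ta / (2 * P.a₁) * u 0 * v 0

/-- `ℓ` (a function of time and space) is a solution on `(0, T)` of the variational formulation
of the continuous model, with initial datum `ℓ₀`. -/
structure IsWeakSolution (P : Tail) (S : Stroke) (l₀ : ℝ → ℝ) (T : ℝ) (l : ℝ → ℝ → ℝ) :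
    Prop where
  /-- `ℓ ∈ L^∞(0, T; L²(0, Λ))` -/
  meas : AEStronglyMeasurable (fun p : ℝ × ℝ => l p.1 p.2)
    (volume.restrict (Ioo 0 T ×ˢ Ioo 0 P.Λ))
  bdd : ∃ M : ℝ≥0, ∀ᵐ t ∂(volume.restrict (Ioo 0 T)), normL2 P.Λ (l t) ≤ M
  /-- `ℓ(t) ∈ 𝒱` for all `t`, and `ℓ ∈ L²(0, T; 𝒱)` -/
  memV : ∀ t ∈ Ioo 0 T, MemV P.Λ (l t)
  memLp_deriv : MemLp (fun p : ℝ × ℝ => deriv (l p.1) p.2) 2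
    (volume.restrict (Ioo 0 T ×ˢ Ioo 0 P.Λ))
  /-- the variational equation, for all `t ∈ (0, T)` and all `v ∈ 𝒱` -/
  eqn : ∀ t ∈ Ioo 0 T, ∀ v : ℝ → ℝ, MemV P.Λ v →
    HasDerivAt (fun s => ∫ y in (0 : ℝ)..P.Λ, l s y * v y)
      (-(P.Λ / 2) * deriv S.L₀ t * v 0 - kappa P (l t) v) t
  /-- the initial condition, attained in `L²(0, Λ)` -/
  init : ∀ y ∈ Icc 0 P.Λ, l 0 y = l₀ y
  tendsto_init : Tendsto (fun t => normL2 P.Λ (fun y => l t y - l₀ y)) (𝓝[>] 0) (𝓝 0)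

/-! ### The `N`-spring model -/

/-- The mesh size `h = Λ / N`, which is the rest length of one spring. -/
def Tail.h (P : Tail) (N : ℕ) : ℝ := P.Λ / N

/-- The nodes `0, h, 2 h, …, N h = Λ` (numbered from `0`). -/
def node (P : Tail) (N j : ℕ) : ℝ := j * P.h N

/-- `g` belongs to the finite element space `𝒱_h`: it is continuous on `[0, Λ]`, affine on each
mesh interval, and vanishes at `Λ`. -/
def MemVh (P : Tail) (N : ℕ) (g : ℝ → ℝ) : Prop :=
  ContinuousOn g (Icc 0 P.Λ) ∧
  (∀ j < N, ∃ a b : ℝ, ∀ y ∈ Icc (node P N j) (node P N (j + 1)), g y = a + b * y) ∧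
  g P.Λ = 0

/-- The hat function of the `j`-th node. -/
def hat (P : Tail) (N j : ℕ) (y : ℝ) : ℝ := max 0 (1 - |y - node P N j| / P.h N)

/-- The stiffness matrix `(K_h)_{ij} = κ(Φ_i, Φ_j)`. -/
def stiffness (P : Tail) (N : ℕ) : Matrix (Fin N) (Fin N) ℝ :=
  Matrix.of fun i j => kappa P (hat P N i) (hat P N j)

/-- The lumped mass matrix: `h` times the identity. -/
def lumpedMass (P : Tail) (N : ℕ) : Matrix (Fin N) (Fin N) ℝ := Matrix.diagonal fun _ => P.h N

/-- The vector of the nodal values of `g` (the node `Λ` excluded). -/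
def nodal (P : Tail) (N : ℕ) (g : ℝ → ℝ) : Fin N → ℝ := fun j => g (node P N j)

/-- The right-hand side `(-(Λ / 2) L₀'(t), 0, …, 0)`. -/
def load (P : Tail) (S : Stroke) (N : ℕ) (t : ℝ) : Fin N → ℝ :=
  fun j => if (j : ℕ) = 0 then -(P.Λ / 2) * deriv S.L₀ t else 0

/-- `ℓ_h` (a function of time and space) solves the `N`-spring model
`d(M L)/dt + K_h L = f`, with `L` the vector of nodal values of `ℓ_h` and `M` the lumped mass
matrix, with initial datum `ℓ_{0,h}`. -/
structure IsDiscreteSolution (P : Tail) (S : Stroke) (N : ℕ) (l₀h : ℝ → ℝ)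
    (lh : ℝ → ℝ → ℝ) : Prop where
  memVh : ∀ t, 0 ≤ t → MemVh P N (lh t)
  eqn : ∀ t, 0 < t →
    HasDerivAt (fun s => (lumpedMass P N).mulVec (nodal P N (lh s)))
      (load P S N t - (stiffness P N).mulVec (nodal P N (lh t))) t
  init : ∀ y ∈ Icc 0 P.Λ, lh 0 y = l₀h y
  cont_init : ContinuousWithinAt (fun s => nodal P N (lh s)) (Ici 0) 0

end ElasticSwimmer

end

noncomputable section

namespace ElasticSwimmer

/-! ### Absolutely continuous functions on an interval -/

section AbsolutelyContinuous

variable {a b Λ : ℝ} {u v : ℝ → ℝ}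

/-! The error is split as (ℓ_h - I_h ℓ) + (I_h ℓ - ℓ), with I_h nodal interpolation. The second part
is the classical interpolation error, h ‖∂_yy ℓ(t)‖ (`normL2_deriv_sub_interp_le`); the first is
controlled by an energy estimate for the nodal errors e_j = ℓ_h(y_j) - ℓ(y_j).

In one dimension I_h is exactly the Ritz projection: κ(I_h u, v) = κ(u, v) for v in 𝒱_h
(`kappa_interp_nodal`). Testing the continuous equation with Φ_j therefore produces K_h applied to
the nodal values of ℓ, and subtracting the two models leaves only the mass-lumping defect, h e_j' +
(K_h e)_j = d/dt (∫ ℓ Φ_j - h ℓ(y_j)) =: -R_j, with e(t) the nodal vector. Pairing with e' and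
completing the square gives d/dt (e · K_h e) ≤ Σ R_j² / (2h) (`energy_le`). Writing R_j = ∫ ∂_yt ℓ ·
`peano` yields Σ R_j² ≤ 3 h² Λ ‖∂_yt ℓ‖² (`sum_sq_integral_peano_le`), so the energy grows by at
most O(h) ∫ ‖∂_yt ℓ‖²; its square root is the √h of the theorem. That rate comes from the node 0,
whose hat has mass h/2 while the lumped matrix assigns it h, so its kernel is not local. The initial
energy is bounded by ‖∂_y(ℓ_{0,h} - ℓ_0)‖², because interpolation contracts the H¹ seminorm and the
value at 0 is controlled by that seminorm.

The remaining work is regularity in time. One may assume that ∂_yt ℓ = g is square integrable; the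
variational equation then upgrades the distributional identity to ∂_y ℓ(s) - ∂_y ℓ_0 = ∫_0^s g for
every s (`weak_ae_deriv_sub`), which makes nodal values and moments of ℓ absolutely continuous in
time. -/

lemma absolutelyContinuousOnInterval_congr (hu : AbsolutelyContinuousOnInterval u a b)
    (h : EqOn u v (uIcc a b)) : AbsolutelyContinuousOnInterval v a b := by
  rw [absolutelyContinuousOnInterval_iff] at hu ⊢
  intro ε hε
  obtain ⟨δ, hδ, H⟩ := hu ε hε
  refine ⟨δ, hδ, fun E hE hE' => ?_⟩
  convert! H E hE hE' using 1
  refine Finset.sum_congr rfl fun i hi => ?_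
  have := hE.1 i hi
  rw [h this.1, h this.2]

lemma absolutelyContinuousOnInterval_const (c : ℝ) :
    AbsolutelyContinuousOnInterval (fun _ => c) a b :=
  contDiffOn_const.absolutelyContinuousOnInterval

lemma absolutelyContinuousOnInterval_sum {ι : Type*} (s : Finset ι) {f : ι → ℝ → ℝ}
    (hf : ∀ i ∈ s, AbsolutelyContinuousOnInterval (f i) a b) :
    AbsolutelyContinuousOnInterval (fun y => ∑ i ∈ s, f i y) a b := by
  classical
  induction s using Finset.induction_on with
  | empty => simpa using absolutelyContinuousOnInterval_const 0
  | insert i s hi ih =>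
    simp_rw [Finset.sum_insert hi]
    exact (hf i (by simp)).add (ih fun j hj => hf j (by simp [hj]))

lemma ae_restrict_Ioo_of_ae_uIcc (hΛ : 0 ≤ Λ) {p : ℝ → Prop}
    (h : ∀ᵐ y, y ∈ uIcc 0 Λ → p y) : ∀ᵐ y ∂(volume.restrict (Ioo 0 Λ)), p y := by
  rw [ae_restrict_iff' measurableSet_Ioo]
  filter_upwards [h] with y hy hy'
  exact hy (by rw [uIcc_of_le hΛ]; exact Ioo_subset_Icc_self hy')

lemma ae_deriv_sub (hΛ : 0 ≤ Λ) (hu : AbsolutelyContinuousOnInterval u 0 Λ)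
    (hv : AbsolutelyContinuousOnInterval v 0 Λ) :
    ∀ᵐ y ∂(volume.restrict (Ioo 0 Λ)), deriv (fun y => u y - v y) y = deriv u y - deriv v y := by
  filter_upwards [ae_restrict_Ioo_of_ae_uIcc hΛ hu.ae_differentiableAt,
    ae_restrict_Ioo_of_ae_uIcc hΛ hv.ae_differentiableAt] with y h1 h2
  exact deriv_fun_sub h1 h2

lemma ae_deriv_add (hΛ : 0 ≤ Λ) (hu : AbsolutelyContinuousOnInterval u 0 Λ)
    (hv : AbsolutelyContinuousOnInterval v 0 Λ) :
    ∀ᵐ y ∂(volume.restrict (Ioo 0 Λ)), deriv (fun y => u y + v y) y = deriv u y + deriv v y := by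
  filter_upwards [ae_restrict_Ioo_of_ae_uIcc hΛ hu.ae_differentiableAt,
    ae_restrict_Ioo_of_ae_uIcc hΛ hv.ae_differentiableAt] with y h1 h2
  exact deriv_fun_add h1 h2

lemma deriv_eq_of_eqOn_Icc (h : EqOn u v (Icc 0 Λ)) {y : ℝ} (hy : y ∈ Ioo 0 Λ) :
    deriv u y = deriv v y := by
  apply Filter.EventuallyEq.deriv_eq
  filter_upwards [isOpen_Ioo.mem_nhds hy] with z hz
  exact h (Ioo_subset_Icc_self hz)

lemma ae_deriv_eq_of_eqOn_Icc (h : EqOn u v (Icc 0 Λ)) :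
    ∀ᵐ y ∂(volume.restrict (Ioo 0 Λ)), deriv u y = deriv v y := by
  rw [ae_restrict_iff' measurableSet_Ioo]
  exact .of_forall fun y hy => deriv_eq_of_eqOn_Icc h hy

lemma MemH1.congr (hΛ : 0 ≤ Λ) (hu : MemH1 Λ u) (h : EqOn u v (Icc 0 Λ)) : MemH1 Λ v :=
  ⟨absolutelyContinuousOnInterval_congr hu.1 (by rwa [uIcc_of_le hΛ]),
    hu.2.ae_eq (ae_deriv_eq_of_eqOn_Icc h)⟩

lemma MemH1.sub (hΛ : 0 ≤ Λ) (hu : MemH1 Λ u) (hv : MemH1 Λ v) :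
    MemH1 Λ (fun y => u y - v y) := by
  refine ⟨hu.1.sub hv.1, (hu.2.sub hv.2).ae_eq ?_⟩
  filter_upwards [ae_deriv_sub hΛ hu.1 hv.1] with y hy using by simp [hy]

lemma integrable_restrict_Ioo_iff (h : a ≤ b) :
    Integrable u (volume.restrict (Ioo a b)) ↔ IntervalIntegrable u volume a b := by
  rw [intervalIntegrable_iff_integrableOn_Ioo_of_le h, IntegrableOn]

lemma intervalIntegral_eq_Ioo (h : a ≤ b) : ∫ y in a..b, u y = ∫ y in Ioo a b, u y := by
  rw [intervalIntegral.integral_of_le h, integral_Ioc_eq_integral_Ioo]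

lemma normL2_eq (hΛ : 0 ≤ Λ) (hu : MemLp u 2 (volume.restrict (Ioo 0 Λ))) :
    normL2 Λ u = ENNReal.ofReal (Real.sqrt (∫ y in (0 : ℝ)..Λ, u y ^ 2)) := by
  rw [normL2, hu.eLpNorm_eq_integral_rpow_norm (by norm_num) (by norm_num),
    intervalIntegral_eq_Ioo hΛ, Real.sqrt_eq_rpow]
  simp

/-- No measurability is needed, so this applies to every time slice of a space-time function,
including the exceptional ones. -/
lemma normL2_sq (f : ℝ → ℝ) : normL2 Λ f ^ 2 = ∫⁻ y in Ioo 0 Λ, ENNReal.ofReal (f y ^ 2) := by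
  rw [normL2, eLpNorm_eq_lintegral_rpow_enorm_toReal (by norm_num) (by norm_num)]
  rw [← ENNReal.rpow_natCast, ← ENNReal.rpow_mul]
  simp only [ENNReal.toReal_ofNat, Nat.cast_ofNat, one_div, ne_eq, OfNat.ofNat_ne_zero,
    not_false_eq_true, inv_mul_cancel₀, ENNReal.rpow_one]
  refine lintegral_congr fun y => ?_
  rw [Real.enorm_eq_ofReal_abs, ENNReal.ofReal_rpow_of_nonneg (abs_nonneg _) (by norm_num)]
  simp

lemma MemLp.intervalIntegrable_sq (hΛ : 0 ≤ Λ) (hu : MemLp u 2 (volume.restrict (Ioo 0 Λ))) :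
    IntervalIntegrable (fun y => u y ^ 2) volume 0 Λ :=
  (integrable_restrict_Ioo_iff hΛ).1 hu.integrable_sq

lemma MemLp.intervalIntegrable_mul (hΛ : 0 ≤ Λ) (hu : MemLp u 2 (volume.restrict (Ioo 0 Λ)))
    (hv : MemLp v 2 (volume.restrict (Ioo 0 Λ))) :
    IntervalIntegrable (fun y => u y * v y) volume 0 Λ :=
  (integrable_restrict_Ioo_iff hΛ).1 (hu.integrable_mul hv)

/-- The Cauchy–Schwarz inequality against a nonnegative weight. -/
lemma sq_integral_mul_le {α : Type*} [MeasurableSpace α] {ν : Measure α} {w g : α → ℝ}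
    (hw : Integrable w ν) (hwg : Integrable (fun x => w x * g x) ν)
    (hwg2 : Integrable (fun x => w x * g x ^ 2) ν) (hw0 : ∀ᵐ x ∂ν, 0 ≤ w x) :
    (∫ x, w x * g x ∂ν) ^ 2 ≤ (∫ x, w x ∂ν) * ∫ x, w x * g x ^ 2 ∂ν := by
  have key : ∀ c : ℝ, 0 ≤ (∫ x, w x ∂ν) * (c * c) + (-2 * ∫ x, w x * g x ∂ν) * c
      + ∫ x, w x * g x ^ 2 ∂ν := by
    intro c
    have h0 : 0 ≤ ∫ x, w x * (g x - c) ^ 2 ∂ν :=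
      integral_nonneg_of_ae (by filter_upwards [hw0] with x hx using by positivity)
    have h1 : ∫ x, w x * (g x - c) ^ 2 ∂ν = ∫ x, (w x * (c * c) + w x * g x * (-2 * c)
        + w x * g x ^ 2) ∂ν := integral_congr_ae (.of_forall fun x => by ring)
    have h2 : Integrable (fun x => w x * (c * c) + w x * g x * (-2 * c)) ν :=
      (hw.mul_const _).add (hwg.mul_const _)
    rw [h1, integral_add h2 hwg2,
      integral_add (hw.mul_const _) (hwg.mul_const _), integral_mul_const, integral_mul_const] at h0
    linarith
  have := discrim_le_zero key
  rw [discrim] at this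
  nlinarith

lemma sq_intervalIntegral_le (hab : a ≤ b) (hu : IntervalIntegrable u volume a b)
    (hu2 : IntervalIntegrable (fun y => u y ^ 2) volume a b) :
    (∫ y in a..b, u y) ^ 2 ≤ (b - a) * ∫ y in a..b, u y ^ 2 := by
  have := sq_integral_mul_le (ν := volume.restrict (Ioo a b)) (w := fun _ => 1) (g := u)
    (integrable_const _) (by simpa using (integrable_restrict_Ioo_iff hab).2 hu)
    (by simpa using (integrable_restrict_Ioo_iff hab).2 hu2) (by simp)
  simpa [intervalIntegral_eq_Ioo hab, hab] using this

lemma MemH1.intervalIntegrable_deriv_sq (hΛ : 0 ≤ Λ) (hu : MemH1 Λ u) :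
    IntervalIntegrable (fun y => deriv u y ^ 2) volume 0 Λ :=
  MemLp.intervalIntegrable_sq hΛ hu.2

/-- Cauchy–Schwarz applied to u(0) = -∫ u'. It absorbs the boundary term of the initial energy. -/
lemma MemV.sq_apply_zero_le (hΛ : 0 ≤ Λ) (hu : MemV Λ u) :
    u 0 ^ 2 ≤ Λ * ∫ y in (0 : ℝ)..Λ, deriv u y ^ 2 := by
  have h := sq_intervalIntegral_le hΛ hu.1.1.intervalIntegrable_deriv
    (hu.1.intervalIntegrable_deriv_sq hΛ)
  rw [hu.1.1.integral_deriv_eq_sub, hu.2] at h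
  simpa using h

end AbsolutelyContinuous

/-! ### The finite element space -/

section Mesh

variable (P : Tail) {N : ℕ}

lemma Tail.h_pos (hN : 1 ≤ N) : 0 < P.h N :=
  div_pos P.Λ_pos (by exact_mod_cast hN)

lemma Tail.K_pos : 0 < P.K := by
  have := P.kt_pos; have := P.mu_pos; have := P.ta_pos; have := Real.pi_pos
  unfold Tail.K; positivity

@[simp] lemma node_zero : node P N 0 = 0 := by simp [node]

lemma node_last (hN : 1 ≤ N) : node P N N = P.Λ := by
  have : (N : ℝ) ≠ 0 := by positivity
  simp only [node, Tail.h]; field_simp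

lemma node_succ (j : ℕ) : node P N (j + 1) = node P N j + P.h N := by
  simp only [node]; push_cast; ring

lemma node_lt_succ (hN : 1 ≤ N) (j : ℕ) : node P N j < node P N (j + 1) := by
  rw [node_succ]; linarith [P.h_pos hN]

lemma node_mono (hN : 1 ≤ N) : Monotone (node P N) :=
  monotone_nat_of_le_succ fun j => (node_lt_succ P hN j).le

lemma node_mem_Icc (hN : 1 ≤ N) {j : ℕ} (hj : j ≤ N) : node P N j ∈ Icc 0 P.Λ := by
  refine ⟨?_, ?_⟩
  · rw [← node_zero P (N := N)]; exact node_mono P hN (Nat.zero_le j)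
  · rw [← node_last P hN]; exact node_mono P hN hj

lemma Icc_node_subset (hN : 1 ≤ N) {k : ℕ} (hk : k < N) :
    Icc (node P N k) (node P N (k + 1)) ⊆ Icc 0 P.Λ :=
  Icc_subset_Icc (node_mem_Icc P hN hk.le).1 (node_mem_Icc P hN hk).2

lemma exists_mem_element (hN : 1 ≤ N) {y : ℝ} (hy : y ∈ Icc 0 P.Λ) :
    ∃ k < N, y ∈ Icc (node P N k) (node P N (k + 1)) := by
  have hh := P.h_pos hN
  have hΛ := node_last P hN
  -- At y = Λ the floor of y / h would be N, one past the last element.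
  rcases eq_or_lt_of_le hy.2 with h | h
  · obtain ⟨n, rfl⟩ : ∃ n, N = n + 1 := ⟨N - 1, by omega⟩
    exact ⟨n, by omega, by rw [h, ← hΛ]; exact ⟨(node_lt_succ P hN n).le, le_rfl⟩⟩
  · have h0 : 0 ≤ y / P.h N := div_nonneg hy.1 hh.le
    refine ⟨⌊y / P.h N⌋₊, ?_, ?_, ?_⟩
    · rw [Nat.floor_lt h0, div_lt_iff₀ hh]
      simpa only [node, hΛ] using lt_of_lt_of_eq h hΛ.symm
    · simpa only [node, ← le_div_iff₀ hh] using Nat.floor_le h0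
    · have := (Nat.lt_floor_add_one (y / P.h N)).le
      rw [div_le_iff₀ hh] at this
      simpa [node] using this

variable {P} in
lemma MemVh.eq_on_element (hN : 1 ≤ N) {v : ℝ → ℝ} (hv : MemVh P N v) {k : ℕ} (hk : k < N)
    {y : ℝ} (hy : y ∈ Icc (node P N k) (node P N (k + 1))) :
    v y = v (node P N k) +
      (v (node P N (k + 1)) - v (node P N k)) / P.h N * (y - node P N k) := by
  have hh := P.h_pos hN
  obtain ⟨a, b, hab⟩ := hv.2.1 k hk
  have hlt := (node_lt_succ P hN k).le
  rw [hab y hy, hab _ ⟨le_rfl, hlt⟩, hab _ ⟨hlt, le_rfl⟩, node_succ]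
  field_simp; ring

variable {P} in
lemma MemVh.deriv_on_element (hN : 1 ≤ N) {v : ℝ → ℝ} (hv : MemVh P N v) {k : ℕ} (hk : k < N)
    {y : ℝ} (hy : y ∈ Ioo (node P N k) (node P N (k + 1))) :
    deriv v y = (v (node P N (k + 1)) - v (node P N k)) / P.h N := by
  have : v =ᶠ[𝓝 y] fun y => v (node P N k) +
      (v (node P N (k + 1)) - v (node P N k)) / P.h N * (y - node P N k) := by
    filter_upwards [isOpen_Ioo.mem_nhds hy] with z hz
    exact hv.eq_on_element hN hk (Ioo_subset_Icc_self hz)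
  rw [this.deriv_eq]
  simp

variable {P} in
lemma MemVh.ext (hN : 1 ≤ N) {u v : ℝ → ℝ} (hu : MemVh P N u) (hv : MemVh P N v)
    (h : ∀ k < N, u (node P N k) = v (node P N k)) : EqOn u v (Icc 0 P.Λ) := by
  intro y hy
  have h' : ∀ k ≤ N, u (node P N k) = v (node P N k) := by
    intro k hk
    rcases hk.eq_or_lt with rfl | hk
    · rw [node_last P hN, hu.2.2, hv.2.2]
    · exact h k hk
  obtain ⟨k, hk, hyk⟩ := exists_mem_element P hN hy
  rw [hu.eq_on_element hN hk hyk, hv.eq_on_element hN hk hyk, h' k hk.le, h' (k + 1) hk]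

lemma hat_lipschitz (hN : 1 ≤ N) (j : ℕ) :
    LipschitzWith (Real.toNNReal (1 / P.h N)) (hat P N j) := by
  have hh := P.h_pos hN
  refine LipschitzWith.of_dist_le_mul fun x y => ?_
  rw [Real.coe_toNNReal _ (by positivity), Real.dist_eq, Real.dist_eq]
  have h1 := abs_max_sub_max_le_abs (1 - |x - node P N j| / P.h N)
    (1 - |y - node P N j| / P.h N) 0
  rw [max_comm, max_comm _ (0 : ℝ)] at h1
  refine h1.trans ?_
  rw [show (1 - |x - node P N j| / P.h N) - (1 - |y - node P N j| / P.h N)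
    = 1 / P.h N * (|y - node P N j| - |x - node P N j|) by ring, abs_mul,
    abs_of_pos (a := 1 / P.h N) (by positivity)]
  refine mul_le_mul_of_nonneg_left ?_ (by positivity)
  refine (abs_abs_sub_abs_le (y - node P N j) (x - node P N j)).trans (le_of_eq ?_)
  rw [abs_sub_comm x y]; congr 1; ring

lemma hat_nonneg (j : ℕ) (y : ℝ) : 0 ≤ hat P N j y := le_max_left _ _

lemma hat_eq_zero (hN : 1 ≤ N) {j : ℕ} {y : ℝ} (h : P.h N ≤ |y - node P N j|) :
    hat P N j y = 0 := by
  have hh := P.h_pos hN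
  have : 1 ≤ |y - node P N j| / P.h N := by rwa [le_div_iff₀ hh, one_mul]
  exact max_eq_left (by linarith)

lemma hat_eq (hN : 1 ≤ N) {j : ℕ} {y : ℝ} (h : |y - node P N j| ≤ P.h N) :
    hat P N j y = 1 - |y - node P N j| / P.h N := by
  have hh := P.h_pos hN
  have : |y - node P N j| / P.h N ≤ 1 := by rwa [div_le_iff₀ hh, one_mul]
  exact max_eq_right (by linarith)

lemma hat_node (hN : 1 ≤ N) (j k : ℕ) : hat P N j (node P N k) = if j = k then 1 else 0 := by
  have hh := P.h_pos hN
  split_ifs with h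
  · subst h; rw [hat_eq P hN] <;> simp [hh.le]
  · apply hat_eq_zero P hN
    rw [node, node, ← sub_mul, abs_mul, abs_of_pos hh]
    have : (1 : ℝ) ≤ |(k : ℝ) - j| := by
      have : (k : ℤ) - j ≠ 0 := by omega
      exact_mod_cast Int.one_le_abs this
    nlinarith

lemma hat_memVh (hN : 1 ≤ N) {j : ℕ} (hj : j < N) : MemVh P N (hat P N j) := by
  have hh := P.h_pos hN
  refine ⟨(hat_lipschitz P hN j).continuous.continuousOn, fun k hk => ?_, ?_⟩
  · rcases lt_trichotomy j k with h | h | h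
    · refine ⟨0, 0, fun y hy => ?_⟩
      have h1 := node_mono P hN (Nat.succ_le_of_lt h)
      rw [Nat.succ_eq_add_one, node_succ] at h1
      rw [hat_eq_zero P hN (le_trans _ (le_abs_self _))]
      · simp
      · linarith [hy.1]
    · subst h
      refine ⟨1 + node P N j / P.h N, - 1 / P.h N, fun y hy => ?_⟩
      rw [node_succ] at hy
      have h0 : 0 ≤ y - node P N j := by linarith [hy.1]
      rw [hat_eq P hN (by rw [abs_of_nonneg h0]; linarith [hy.2]), abs_of_nonneg h0]
      ring
    · rcases (Nat.succ_le_of_lt h).eq_or_lt with h' | h'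
      · refine ⟨1 - node P N j / P.h N, 1 / P.h N, fun y hy => ?_⟩
        rw [← Nat.succ_eq_add_one, h'] at hy
        have h1 := node_succ P (N := N) k
        rw [← Nat.succ_eq_add_one, h'] at h1
        have h0 : y - node P N j ≤ 0 := by linarith [hy.2]
        rw [hat_eq P hN (by rw [abs_of_nonpos h0]; linarith [hy.1]), abs_of_nonpos h0]
        ring
      · refine ⟨0, 0, fun y hy => ?_⟩
        have h1 := node_mono P hN (Nat.succ_le_of_lt h')
        rw [Nat.succ_eq_add_one, node_succ] at h1
        rw [hat_eq_zero P hN (le_trans _ (neg_le_abs _))]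
        · simp
        · linarith [hy.2]
  · rw [← node_last P hN, hat_node P hN, if_neg hj.ne]

/-- The function of the finite element space with prescribed nodal values. -/
def interp (P : Tail) {N : ℕ} (x : Fin N → ℝ) (y : ℝ) : ℝ := ∑ j, x j * hat P N j y

lemma interp_memVh (hN : 1 ≤ N) (x : Fin N → ℝ) : MemVh P N (interp P x) := by
  refine ⟨?_, fun k hk => ?_, ?_⟩
  · exact continuousOn_finsetSum _ fun j _ =>
      continuousOn_const.mul (hat_memVh P hN j.2).1
  · choose a b hab using fun j : Fin N => (hat_memVh P hN j.2).2.1 k hk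
    refine ⟨∑ j, x j * a j, ∑ j, x j * b j, fun y hy => ?_⟩
    rw [interp, Finset.sum_mul, ← Finset.sum_add_distrib]
    exact Finset.sum_congr rfl fun j _ => by rw [hab j y hy]; ring
  · exact Finset.sum_eq_zero fun j _ => by rw [(hat_memVh P hN j.2).2.2, mul_zero]

lemma interp_node (hN : 1 ≤ N) (x : Fin N → ℝ) (k : Fin N) :
    interp P x (node P N k) = x k := by
  simp [interp, hat_node P hN, Fin.val_inj]

lemma interp_nodal_node (hN : 1 ≤ N) {u : ℝ → ℝ} (hu : u P.Λ = 0) {k : ℕ} (hk : k ≤ N) :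
    interp P (nodal P N u) (node P N k) = u (node P N k) := by
  rcases hk.eq_or_lt with rfl | hk
  · rw [node_last P hN, hu, (interp_memVh P hN _).2.2]
  · exact interp_node P hN (nodal P N u) ⟨k, hk⟩

variable {P} in
lemma MemVh.eqOn_interp (hN : 1 ≤ N) {v : ℝ → ℝ} (hv : MemVh P N v) :
    EqOn v (interp P (nodal P N v)) (Icc 0 P.Λ) :=
  hv.ext hN (interp_memVh P hN _) fun _ hk => (interp_nodal_node P hN hv.2.2 hk.le).symm

variable {P} in
lemma MemVh.absolutelyContinuous (hN : 1 ≤ N) {v : ℝ → ℝ} (hv : MemVh P N v) :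
    AbsolutelyContinuousOnInterval v 0 P.Λ := by
  refine absolutelyContinuousOnInterval_congr ?_
    (by rw [uIcc_of_le P.Λ_pos.le]; exact (hv.eqOn_interp hN).symm)
  exact absolutelyContinuousOnInterval_sum _ fun j _ =>
    (hat_lipschitz P hN j).lipschitzOnWith.absolutelyContinuousOnInterval.const_mul _

lemma ae_of_forall_element (hN : 1 ≤ N) {p : ℝ → Prop}
    (h : ∀ k < N, ∀ y ∈ Ioo (node P N k) (node P N (k + 1)), p y) :
    ∀ᵐ y ∂(volume.restrict (Ioo 0 P.Λ)), p y := by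
  rw [ae_restrict_iff' measurableSet_Ioo]
  have : ∀ᵐ y : ℝ, y ∉ range (node P N) :=
    (countable_range (node P N)).ae_notMem volume
  filter_upwards [this] with y hy hy'
  obtain ⟨k, hk, hyk⟩ := exists_mem_element P hN (Ioo_subset_Icc_self hy')
  exact h k hk y ⟨lt_of_le_of_ne hyk.1 fun e => hy ⟨k, e⟩,
    lt_of_le_of_ne hyk.2 fun e => hy ⟨k + 1, e.symm⟩⟩

variable {P} in
lemma MemVh.memV (hN : 1 ≤ N) {v : ℝ → ℝ} (hv : MemVh P N v) : MemV P.Λ v := by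
  refine ⟨⟨hv.absolutelyContinuous hN, ?_⟩, hv.2.2⟩
  refine MemLp.of_bound (measurable_deriv v).aestronglyMeasurable
    (∑ k ∈ Finset.range N, |(v (node P N (k + 1)) - v (node P N k)) / P.h N|) ?_
  refine ae_of_forall_element P hN fun k hk y hy => ?_
  rw [hv.deriv_on_element hN hk hy, Real.norm_eq_abs]
  exact Finset.single_le_sum
    (f := fun k => |(v (node P N (k + 1)) - v (node P N k)) / P.h N|)
    (fun i _ => abs_nonneg _) (Finset.mem_range.2 hk)

lemma sum_integral_elements (hN : 1 ≤ N) {f : ℝ → ℝ} (hf : IntervalIntegrable f volume 0 P.Λ) :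
    ∑ k ∈ Finset.range N, ∫ y in (node P N k)..(node P N (k + 1)), f y =
      ∫ y in (0 : ℝ)..P.Λ, f y := by
  rw [intervalIntegral.sum_integral_adjacent_intervals, node_zero, node_last P hN]
  intro k hk
  refine hf.mono_set ?_
  rw [uIcc_of_le (node_lt_succ P hN k).le, uIcc_of_le P.Λ_pos.le]
  exact Icc_node_subset P hN hk

lemma absolutelyContinuous_element (hN : 1 ≤ N) {u : ℝ → ℝ}
    (hu : AbsolutelyContinuousOnInterval u 0 P.Λ) {k : ℕ} (hk : k < N) :
    AbsolutelyContinuousOnInterval u (node P N k) (node P N (k + 1)) := by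
  refine hu.mono ?_
  rw [uIcc_of_le (node_lt_succ P hN k).le, uIcc_of_le P.Λ_pos.le]
  exact Icc_node_subset P hN hk

/-- The derivative of v is constant on each element, so u enters only through its nodal increments.
This is why the interpolant is the Ritz projection. -/
lemma integral_deriv_mul_deriv_memVh (hN : 1 ≤ N) {u v : ℝ → ℝ}
    (hu : MemH1 P.Λ u) (hv : MemVh P N v) :
    ∫ y in (0 : ℝ)..P.Λ, deriv u y * deriv v y =
      ∑ k ∈ Finset.range N, (u (node P N (k + 1)) - u (node P N k)) *
        ((v (node P N (k + 1)) - v (node P N k)) / P.h N) := by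
  rw [← sum_integral_elements P hN
    (MemLp.intervalIntegrable_mul P.Λ_pos.le hu.2 (hv.memV hN).1.2)]
  refine Finset.sum_congr rfl fun k hk => ?_
  have hk := Finset.mem_range.1 hk
  rw [← (absolutelyContinuous_element P hN hu.1 hk).integral_deriv_eq_sub,
    ← intervalIntegral.integral_mul_const, intervalIntegral_eq_Ioo (node_lt_succ P hN k).le,
    intervalIntegral_eq_Ioo (node_lt_succ P hN k).le]
  exact setIntegral_congr_fun measurableSet_Ioo fun y hy => by
    simp only [hv.deriv_on_element hN hk hy]

lemma kappa_memVh (hN : 1 ≤ N) {u v : ℝ → ℝ} (hu : MemH1 P.Λ u) (hv : MemVh P N v) :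
    kappa P u v = P.Λ ^ 2 * P.K * (∑ k ∈ Finset.range N,
      (u (node P N (k + 1)) - u (node P N k)) *
        ((v (node P N (k + 1)) - v (node P N k)) / P.h N)) +
      P.Λ * P.K * P.ta / (2 * P.a₁) * u (node P N 0) * v (node P N 0) := by
  rw [kappa, integral_deriv_mul_deriv_memVh P hN hu hv, node_zero]

lemma kappa_comm (u v : ℝ → ℝ) : kappa P u v = kappa P v u := by
  unfold kappa
  simp_rw [mul_comm (deriv u _)]
  ring

lemma stiffness_symm (i j : Fin N) : stiffness P N i j = stiffness P N j i :=
  kappa_comm P _ _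

lemma kappa_interp_left (hN : 1 ≤ N) (x : Fin N → ℝ) {v : ℝ → ℝ} (hv : MemVh P N v) :
    kappa P (interp P x) v = ∑ i, x i * kappa P (hat P N i) v := by
  rw [kappa_memVh P hN ((interp_memVh P hN x).memV hN).1 hv]
  simp_rw [fun i : Fin N => kappa_memVh P hN ((hat_memVh P hN i.2).memV hN).1 hv, interp]
  simp_rw [← Finset.sum_sub_distrib, mul_add, Finset.sum_add_distrib]
  congr 1
  · simp_rw [Finset.sum_mul, Finset.mul_sum]
    rw [Finset.sum_comm]
    exact Finset.sum_congr rfl fun i _ => Finset.sum_congr rfl fun k _ => by ring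
  · rw [Finset.mul_sum, Finset.sum_mul]
    exact Finset.sum_congr rfl fun i _ => by ring

lemma kappa_interp_nodal (hN : 1 ≤ N) {u v : ℝ → ℝ} (hu : MemV P.Λ u) (hv : MemVh P N v) :
    kappa P (interp P (nodal P N u)) v = kappa P u v := by
  rw [kappa_memVh P hN ((interp_memVh P hN _).memV hN).1 hv, kappa_memVh P hN hu.1 hv,
    interp_nodal_node P hN hu.2 (Nat.zero_le N)]
  congr 2
  refine Finset.sum_congr rfl fun k hk => ?_
  have hk := Finset.mem_range.1 hk
  rw [interp_nodal_node P hN hu.2 hk, interp_nodal_node P hN hu.2 hk.le]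

/-- The stiffness part of the discrete scheme has no consistency error: the nodal vector of any u in
𝒱 reproduces κ(u, Φ_j) exactly. -/
lemma stiffness_mulVec_nodal (hN : 1 ≤ N) {u : ℝ → ℝ} (hu : MemV P.Λ u) (j : Fin N) :
    (stiffness P N).mulVec (nodal P N u) j = kappa P u (hat P N j) := by
  rw [← kappa_interp_nodal P hN hu (hat_memVh P hN j.2),
    kappa_interp_left P hN _ (hat_memVh P hN j.2)]
  simp only [Matrix.mulVec, dotProduct]
  refine Finset.sum_congr rfl fun i _ => ?_
  rw [stiffness_symm, mul_comm]; rfl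

/-- The coefficient of the boundary term of `κ`. -/
def Tail.bdry (P : Tail) : ℝ := P.Λ * P.K * P.ta / (2 * P.a₁)

lemma Tail.bdry_pos : 0 < P.bdry := by
  have := P.Λ_pos; have := P.K_pos; have := P.ta_pos; have := P.a₁_pos
  unfold Tail.bdry; positivity

lemma sum_stiffness_eq (hN : 1 ≤ N) (x : Fin N → ℝ) :
    ∑ i, x i * (stiffness P N).mulVec x i =
      P.Λ ^ 2 * P.K * (∫ y in (0 : ℝ)..P.Λ, deriv (interp P x) y ^ 2) +
        P.bdry * interp P x 0 ^ 2 := by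
  have h1 : nodal P N (interp P x) = x := funext fun k => interp_node P hN x k
  have h2 : ∀ i, (stiffness P N).mulVec x i = kappa P (hat P N i) (interp P x) := by
    intro i
    conv_lhs => rw [← h1]
    rw [stiffness_mulVec_nodal P hN ((interp_memVh P hN x).memV hN), kappa_comm]
  simp_rw [h2]
  rw [← kappa_interp_left P hN x (interp_memVh P hN x), kappa, Tail.bdry]
  simp_rw [← pow_two]
  ring

/-- The nodal interpolant is the best approximation in the energy seminorm. -/
lemma integral_deriv_interp_sq_le (hN : 1 ≤ N) {u : ℝ → ℝ} (hu : MemV P.Λ u) :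
    ∫ y in (0 : ℝ)..P.Λ, deriv (interp P (nodal P N u)) y ^ 2 ≤
      ∫ y in (0 : ℝ)..P.Λ, deriv u y ^ 2 := by
  set v := interp P (nodal P N u) with hv
  have hvV := interp_memVh P hN (nodal P N u)
  have hv1 := (hvV.memV hN).1
  -- Orthogonality of u' - v' to v'; the bound is then Pythagoras.
  have h1 : ∫ y in (0 : ℝ)..P.Λ, deriv u y * deriv v y =
      ∫ y in (0 : ℝ)..P.Λ, deriv v y * deriv v y := by
    rw [integral_deriv_mul_deriv_memVh P hN hu.1 hvV, integral_deriv_mul_deriv_memVh P hN hv1 hvV]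
    refine Finset.sum_congr rfl fun k hk => ?_
    have hk := Finset.mem_range.1 hk
    rw [interp_nodal_node P hN hu.2 hk, interp_nodal_node P hN hu.2 hk.le]
  have hΛ := P.Λ_pos.le
  have i1 := hu.1.intervalIntegrable_deriv_sq hΛ
  have i2 := MemLp.intervalIntegrable_mul hΛ hu.1.2 hv1.2
  have i3 := MemLp.intervalIntegrable_mul hΛ hv1.2 hv1.2
  have h0 : 0 ≤ ∫ y in (0 : ℝ)..P.Λ, (deriv u y - deriv v y) ^ 2 :=
    intervalIntegral.integral_nonneg hΛ fun _ _ => sq_nonneg _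
  have h2 : ∫ y in (0 : ℝ)..P.Λ, (deriv u y - deriv v y) ^ 2 = ∫ y in (0 : ℝ)..P.Λ,
      (deriv u y ^ 2 - 2 * (deriv u y * deriv v y) + deriv v y * deriv v y) :=
    intervalIntegral.integral_congr fun y _ => by ring
  rw [h2, intervalIntegral.integral_add (i1.sub (i2.const_mul 2)) i3,
    intervalIntegral.integral_sub i1 (i2.const_mul 2), intervalIntegral.integral_const_mul, h1] at h0
  simp_rw [pow_two (deriv v _)]
  linarith

end Mesh

/-! ### The interpolation error -/

section InterpolationError

variable {Λ : ℝ} {u w : ℝ → ℝ}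

/-- An absolutely continuous u is a primitive of u', hence of the continuous w, and such a primitive
is differentiable at every interior point. This justifies reading ∂_yy as the iterated `deriv`. -/
lemma hasDerivAt_of_ae_deriv_eq (hu : AbsolutelyContinuousOnInterval u 0 Λ)
    (hw : ContinuousOn w (Icc 0 Λ)) (h : ∀ᵐ y ∂(volume.restrict (Ioo 0 Λ)), deriv u y = w y)
    {y : ℝ} (hy : y ∈ Ioo 0 Λ) : HasDerivAt u (w y) y := by
  have hΛ : 0 ≤ Λ := (hy.1.trans hy.2).le
  have h1 : ∀ z ∈ Ioo 0 Λ, u 0 + ∫ x in (0 : ℝ)..z, w x = u z := by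
    intro z hz
    have hz' : AbsolutelyContinuousOnInterval u 0 z := hu.mono (by
      rw [uIcc_of_le hΛ, uIcc_of_le hz.1.le]; exact Icc_subset_Icc_right hz.2.le)
    have h2 : ∫ x in (0 : ℝ)..z, w x = ∫ x in (0 : ℝ)..z, deriv u x := by
      rw [intervalIntegral_eq_Ioo hz.1.le, intervalIntegral_eq_Ioo hz.1.le]
      refine integral_congr_ae ?_
      filter_upwards [ae_restrict_of_ae_restrict_of_subset (Ioo_subset_Ioo_right hz.2.le) h]
        with x hx using hx.symm
    rw [h2, hz'.integral_deriv_eq_sub]; ring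
  have h3 : HasDerivAt (fun z => u 0 + ∫ x in (0 : ℝ)..z, w x) (w y) y := by
    refine (intervalIntegral.integral_hasDerivAt_right ?_ ?_ ?_).const_add _
    · refine (hw.mono ?_).intervalIntegrable
      rw [uIcc_of_le hy.1.le]; exact Icc_subset_Icc_right hy.2.le
    · exact (hw.mono Ioo_subset_Icc_self).stronglyMeasurableAtFilter isOpen_Ioo y hy
    · exact hw.continuousAt (Icc_mem_nhds hy.1 hy.2)
  refine h3.congr_of_eventuallyEq ?_
  filter_upwards [isOpen_Ioo.mem_nhds hy] with z hz using (h1 z hz).symm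

lemma MemH2.exists_hasDerivAt (hu : MemH2 Λ u) :
    ∃ w, MemH1 Λ w ∧ (∀ y ∈ Ioo 0 Λ, HasDerivAt u (w y) y) ∧
      ∀ y ∈ Ioo 0 Λ, deriv (deriv u) y = deriv w y := by
  obtain ⟨hu1, w, hw, h⟩ := hu
  have key : ∀ y ∈ Ioo 0 Λ, HasDerivAt u (w y) y := fun y hy =>
    hasDerivAt_of_ae_deriv_eq hu1.1
      (by simpa [uIcc_of_le (hy.1.trans hy.2).le] using hw.1.continuousOn) h hy
  refine ⟨w, hw, key, fun y hy => ?_⟩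
  apply Filter.EventuallyEq.deriv_eq
  filter_upwards [isOpen_Ioo.mem_nhds hy] with z hz using (key z hz).deriv

lemma sq_sub_le_integral_deriv_sq {a b x y : ℝ} (hab : a ≤ b)
    (hw : AbsolutelyContinuousOnInterval w a b)
    (hw2 : IntervalIntegrable (fun y => deriv w y ^ 2) volume a b)
    (hx : x ∈ Icc a b) (hy : y ∈ Icc a b) :
    (w y - w x) ^ 2 ≤ (b - a) * ∫ z in a..b, deriv w z ^ 2 := by
  have hsub : uIcc x y ⊆ uIcc a b := by
    rw [uIcc_of_le hab]; exact uIcc_subset_Icc hx hy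
  have hi := hw.intervalIntegrable_deriv.abs
  have h1 : |w y - w x| ≤ ∫ z in a..b, |deriv w z| := by
    rw [← (hw.mono hsub).integral_deriv_eq_sub]
    refine (intervalIntegral.norm_integral_le_abs_integral_norm (f := deriv w)).trans ?_
    refine (intervalIntegral.abs_integral_mono_interval ?_
      (.of_forall fun _ => norm_nonneg _) hi).trans (le_of_eq ?_)
    · rw [uIoc_of_le hab, uIoc]
      exact Ioc_subset_Ioc (le_min hx.1 hy.1) (max_le hx.2 hy.2)
    · exact abs_of_nonneg (intervalIntegral.integral_nonneg hab fun _ _ => abs_nonneg _)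
  have h2 := sq_intervalIntegral_le hab hi (by simpa using hw2)
  simp only [sq_abs] at h2
  calc (w y - w x) ^ 2 = |w y - w x| ^ 2 := (sq_abs _).symm
    _ ≤ _ := by gcongr
    _ ≤ _ := h2

/-- On an element the slope of the interpolant equals u'(ξ) for some ξ by the mean value theorem.
The oscillation of u' costs one factor h by Cauchy–Schwarz, and integrating over the element costs
the other. -/
lemma integral_deriv_sub_interp_sq_le (P : Tail) {N : ℕ} (hN : 1 ≤ N) (hu : MemV P.Λ u)
    (hu2 : MemH2 P.Λ u) :
    ∫ y in (0 : ℝ)..P.Λ, (deriv u y - deriv (interp P (nodal P N u)) y) ^ 2 ≤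
      P.h N ^ 2 * ∫ y in (0 : ℝ)..P.Λ, deriv (deriv u) y ^ 2 := by
  obtain ⟨w, hw, hwu, hw2⟩ := hu2.exists_hasDerivAt
  have hΛ := P.Λ_pos.le
  have hI := interp_memVh P hN (nodal P N u)
  have hwi := hw.intervalIntegrable_deriv_sq hΛ
  have e1 : ∫ y in (0 : ℝ)..P.Λ, deriv (deriv u) y ^ 2 = ∫ y in (0 : ℝ)..P.Λ, deriv w y ^ 2 := by
    rw [intervalIntegral_eq_Ioo hΛ, intervalIntegral_eq_Ioo hΛ]
    exact setIntegral_congr_fun measurableSet_Ioo fun y hy => by simp only [hw2 y hy]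
  have hi : IntervalIntegrable
      (fun y => (deriv u y - deriv (interp P (nodal P N u)) y) ^ 2) volume 0 P.Λ :=
    MemLp.intervalIntegrable_sq hΛ (hu.1.2.sub (hI.memV hN).1.2)
  rw [e1, ← sum_integral_elements P hN hi, ← sum_integral_elements P hN hwi, Finset.mul_sum]
  refine Finset.sum_le_sum fun k hk => ?_
  have hk := Finset.mem_range.1 hk
  have hlt := node_lt_succ P hN k
  have hsub := Icc_node_subset P hN hk
  have hsub' : Ioo (node P N k) (node P N (k + 1)) ⊆ Ioo 0 P.Λ :=
    Ioo_subset_Ioo (node_mem_Icc P hN hk.le).1 (node_mem_Icc P hN hk).2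
  have hwik : IntervalIntegrable (fun y => deriv w y ^ 2) volume
      (node P N k) (node P N (k + 1)) := hwi.mono_set (by
    rwa [uIcc_of_le hlt.le, uIcc_of_le hΛ])
  have hhk : node P N (k + 1) - node P N k = P.h N := by rw [node_succ]; ring
  obtain ⟨ξ, hξ, hξ'⟩ := exists_deriv_eq_slope u hlt
    (by simpa [uIcc_of_le hlt.le] using (absolutelyContinuous_element P hN hu.1.1 hk).continuousOn)
    fun y hy => (hwu y (hsub' hy)).differentiableAt.differentiableWithinAt
  have key : ∀ y ∈ Ioo (node P N k) (node P N (k + 1)),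
      (deriv u y - deriv (interp P (nodal P N u)) y) ^ 2 ≤
        P.h N * ∫ y in (node P N k)..(node P N (k + 1)), deriv w y ^ 2 := by
    intro y hy
    rw [hI.deriv_on_element hN hk hy, interp_nodal_node P hN hu.2 hk,
      interp_nodal_node P hN hu.2 hk.le, ← hhk, ← hξ', (hwu y (hsub' hy)).deriv,
      (hwu ξ (hsub' hξ)).deriv]
    exact sq_sub_le_integral_deriv_sq hlt.le (absolutelyContinuous_element P hN hw.1 hk) hwik
      (Ioo_subset_Icc_self hξ) (Ioo_subset_Icc_self hy)
  have hik := hi.mono_set (by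
    rwa [uIcc_of_le hlt.le, uIcc_of_le hΛ] : uIcc (node P N k) (node P N (k + 1)) ⊆ uIcc 0 P.Λ)
  calc _ ≤ ∫ _ in (node P N k)..(node P N (k + 1)),
        P.h N * ∫ y in (node P N k)..(node P N (k + 1)), deriv w y ^ 2 := by
        rw [intervalIntegral_eq_Ioo hlt.le, intervalIntegral_eq_Ioo hlt.le]
        exact setIntegral_mono_on ((integrable_restrict_Ioo_iff hlt.le).2 hik)
          (integrable_const _) measurableSet_Ioo key
    _ = _ := by rw [intervalIntegral.integral_const, hhk, smul_eq_mul]; ring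

/-- The interpolation error in the energy norm, for functions in `H²(0, Λ)`. -/
lemma normL2_deriv_sub_interp_le (P : Tail) {N : ℕ} (hN : 1 ≤ N) (hu : MemV P.Λ u) :
    normL2 P.Λ (deriv fun y => interp P (nodal P N u) y - u y) ≤
      ENNReal.ofReal (P.h N) * normDyy P.Λ u := by
  have hh := P.h_pos hN
  have hΛ := P.Λ_pos.le
  have hI := ((interp_memVh P hN (nodal P N u)).memV hN).1
  unfold normDyy
  split_ifs with hu2
  · obtain ⟨w, hw, -, hw2⟩ := hu2.exists_hasDerivAt
    have hL : MemLp (deriv (deriv u)) 2 (volume.restrict (Ioo 0 P.Λ)) := by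
      refine hw.2.ae_eq ?_
      rw [EventuallyEq, ae_restrict_iff' measurableSet_Ioo]
      exact .of_forall fun y hy => (hw2 y hy).symm
    rw [normL2_eq hΛ (hI.sub hΛ hu.1).2, normL2_eq hΛ hL, ← ENNReal.ofReal_mul hh.le]
    refine ENNReal.ofReal_le_ofReal ?_
    rw [← Real.sqrt_sq hh.le, ← Real.sqrt_mul (sq_nonneg _)]
    refine Real.sqrt_le_sqrt (le_trans (le_of_eq ?_) (integral_deriv_sub_interp_sq_le P hN hu hu2))
    rw [intervalIntegral_eq_Ioo hΛ, intervalIntegral_eq_Ioo hΛ]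
    refine integral_congr_ae ?_
    filter_upwards [ae_deriv_sub hΛ hI.1 hu.1.1] with y hy
    rw [hy]; ring
  -- Outside H² the right-hand side is h · ∞, which is ∞ because h > 0.
  · rw [ENNReal.mul_top (by simpa using hh)]
    exact le_top

end InterpolationError

/-! ### Test functions -/

section TestFunctions

/-- Smooth functions with compact support in `(a, b)`. -/
structure IsTest (a b : ℝ) (β : ℝ → ℝ) : Prop where
  contDiff : ContDiff ℝ ∞ β
  compact : HasCompactSupport β
  subset : tsupport β ⊆ Ioo a b

variable {a b Λ : ℝ} {β : ℝ → ℝ}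

lemma IsTest.deriv (h : IsTest a b β) : IsTest a b (deriv β) where
  contDiff := (contDiff_infty_iff_deriv.1 h.contDiff).2
  compact := h.compact.deriv
  subset := (tsupport_deriv_subset).trans h.subset

lemma IsTest.eq_zero (h : IsTest a b β) {y : ℝ} (hy : y ∉ Ioo a b) : β y = 0 :=
  image_eq_zero_of_notMem_tsupport fun h' => hy (h.subset h')

lemma IsTest.continuous (h : IsTest a b β) : Continuous β := h.contDiff.continuous

lemma IsTest.exists_bound (h : IsTest a b β) : ∃ C, ∀ y, ‖β y‖ ≤ C :=
  h.compact.exists_bound_of_continuous h.continuous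

lemma IsTest.absolutelyContinuous (h : IsTest a b β) (c d : ℝ) :
    AbsolutelyContinuousOnInterval β c d :=
  (h.contDiff.of_le (by norm_num)).contDiffOn.absolutelyContinuousOnInterval

lemma IsTest.memLp (h : IsTest a b β) {Λ : ℝ} : MemLp β 2 (volume.restrict (Ioo 0 Λ)) := by
  obtain ⟨C, hC⟩ := h.exists_bound
  exact MemLp.of_bound h.continuous.aestronglyMeasurable C (.of_forall hC)

lemma IsTest.memV (h : IsTest 0 Λ β) : MemV Λ β :=
  ⟨⟨h.absolutelyContinuous _ _, h.deriv.memLp⟩, h.eq_zero (by simp)⟩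

lemma ae_eq_zero_of_forall_isTest {f : ℝ → ℝ} (hf : Integrable f (volume.restrict (Ioo a b)))
    (h : ∀ β, IsTest a b β → ∫ x in Ioo a b, f x * β x = 0) :
    ∀ᵐ x ∂(volume.restrict (Ioo a b)), f x = 0 := by
  rw [ae_restrict_iff' measurableSet_Ioo]
  have hf' : IntegrableOn f (Ioo a b) := hf
  refine isOpen_Ioo.ae_eq_zero_of_integral_contDiff_smul_eq_zero hf'.locallyIntegrableOn ?_
  intro β h1 h2 h3
  have hβ : IsTest a b β := ⟨h1, h2, h3⟩
  rw [← h β hβ, ← setIntegral_eq_integral_of_forall_compl_eq_zero (s := Ioo a b)]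
  · exact integral_congr_ae (.of_forall fun x => by simp [mul_comm])
  · intro x hx; simp [hβ.eq_zero hx]

/-- Tensor products α(s) β(y) are the only test functions required: they separate the time and space
arguments below. -/
lemma HasWeakDyt.integral_eq {T : ℝ} {l g : ℝ → ℝ → ℝ} (hg : HasWeakDyt Λ T l g)
    {α : ℝ → ℝ} (hα : IsTest 0 T α) (hβ : IsTest 0 Λ β) :
    ∫ p in Ioo 0 T ×ˢ Ioo 0 Λ, l p.1 p.2 * (_root_.deriv α p.1 * _root_.deriv β p.2) =
      ∫ p in Ioo 0 T ×ˢ Ioo 0 Λ, g p.1 p.2 * (α p.1 * β p.2) := by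
  have hcl : IsClosed (tsupport α ×ˢ tsupport β) :=
    (isClosed_tsupport α).prod (isClosed_tsupport β)
  have hsupp : Function.support (fun p : ℝ × ℝ => α p.1 * β p.2) ⊆ tsupport α ×ˢ tsupport β := by
    intro p hp
    exact ⟨subset_tsupport _ (left_ne_zero_of_mul hp), subset_tsupport _ (right_ne_zero_of_mul hp)⟩
  have hts : tsupport (fun p : ℝ × ℝ => α p.1 * β p.2) ⊆ tsupport α ×ˢ tsupport β :=
    closure_minimal hsupp hcl
  rw [← hg.2 (fun p => α p.1 * β p.2)
    ((hα.contDiff.comp contDiff_fst).mul (hβ.contDiff.comp contDiff_snd))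
    ((IsCompact.prod hα.compact hβ.compact).of_isClosed_subset (isClosed_tsupport _) hts)
    (hts.trans (prod_mono hα.subset hβ.subset))]
  refine integral_congr_ae (.of_forall fun p => ?_)
  simp [deriv_const_mul_field, deriv_mul_const_field]

end TestFunctions

/-! ### Space-time integrability -/

section SpaceTime

variable {T Λ : ℝ}

lemma restrict_prod_eq : (volume : Measure (ℝ × ℝ)).restrict (Ioo 0 T ×ˢ Ioo 0 Λ) =
    (volume.restrict (Ioo 0 T)).prod (volume.restrict (Ioo 0 Λ)) := by
  rw [Measure.volume_eq_prod, Measure.prod_restrict]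

lemma lintegral_normL2_sq_eq {f : ℝ → ℝ → ℝ} (hf : AEStronglyMeasurable
    (fun p : ℝ × ℝ => f p.1 p.2) (volume.restrict (Ioo 0 T ×ˢ Ioo 0 Λ))) :
    ∫⁻ s in Ioo 0 T, normL2 Λ (f s) ^ 2 =
      ∫⁻ p in Ioo 0 T ×ˢ Ioo 0 Λ, ENNReal.ofReal (f p.1 p.2 ^ 2) := by
  rw [restrict_prod_eq] at hf ⊢
  have h : AEMeasurable (fun p : ℝ × ℝ => ENNReal.ofReal (f p.1 p.2 ^ 2))
      ((volume.restrict (Ioo 0 T)).prod (volume.restrict (Ioo 0 Λ))) :=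
    (hf.pow 2).aemeasurable.ennreal_ofReal
  rw [lintegral_prod _ h]
  simp_rw [normL2_sq]

lemma memLp_two_of_lintegral_ne_top {f : ℝ → ℝ → ℝ} (hf : AEStronglyMeasurable
    (fun p : ℝ × ℝ => f p.1 p.2) (volume.restrict (Ioo 0 T ×ˢ Ioo 0 Λ)))
    (h : ∫⁻ s in Ioo 0 T, normL2 Λ (f s) ^ 2 ≠ ⊤) :
    MemLp (fun p : ℝ × ℝ => f p.1 p.2) 2 (volume.restrict (Ioo 0 T ×ˢ Ioo 0 Λ)) := by
  rw [memLp_two_iff_integrable_sq hf]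
  refine ⟨hf.pow 2, ?_⟩
  rw [lintegral_normL2_sq_eq hf] at h
  rw [hasFiniteIntegral_iff_ofReal (.of_forall fun _ => sq_nonneg _)]
  exact h.lt_top

lemma lintegral_normL2_sq_eq_ofReal {f : ℝ → ℝ → ℝ} (hf : MemLp
    (fun p : ℝ × ℝ => f p.1 p.2) 2 (volume.restrict (Ioo 0 T ×ˢ Ioo 0 Λ))) :
    ∫⁻ s in Ioo 0 T, normL2 Λ (f s) ^ 2 =
      ENNReal.ofReal (∫ p in Ioo 0 T ×ˢ Ioo 0 Λ, f p.1 p.2 ^ 2) := by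
  rw [lintegral_normL2_sq_eq hf.1, ofReal_integral_eq_lintegral_ofReal hf.integrable_sq
    (.of_forall fun _ => sq_nonneg _)]

lemma IsWeakSolution.memLp {P : Tail} {S : Stroke} {l₀ : ℝ → ℝ} {l : ℝ → ℝ → ℝ}
    (h : IsWeakSolution P S l₀ T l) :
    MemLp (fun p : ℝ × ℝ => l p.1 p.2) 2 (volume.restrict (Ioo 0 T ×ˢ Ioo 0 P.Λ)) := by
  refine memLp_two_of_lintegral_ne_top h.meas ?_
  obtain ⟨M, hM⟩ := h.bdd
  refine ne_top_of_le_ne_top (b := ∫⁻ _ in Ioo 0 T, (M : ℝ≥0∞) ^ 2) ?_ ?_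
  · rw [lintegral_const, Measure.restrict_apply_univ, Real.volume_Ioo]
    exact ENNReal.mul_ne_top (by simp) ENNReal.ofReal_ne_top
  · refine lintegral_mono_ae ?_
    filter_upwards [hM] with s hs
    gcongr

lemma integrable_mul_bounded {f : ℝ → ℝ → ℝ} {w : ℝ × ℝ → ℝ} (hf : MemLp
    (fun p : ℝ × ℝ => f p.1 p.2) 2 (volume.restrict (Ioo 0 T ×ˢ Ioo 0 Λ)))
    (hw : Measurable w) {B : ℝ} (hB : ∀ p, ‖w p‖ ≤ B) :
    Integrable (fun p : ℝ × ℝ => f p.1 p.2 * w p)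
      ((volume.restrict (Ioo 0 T)).prod (volume.restrict (Ioo 0 Λ))) := by
  rw [restrict_prod_eq] at hf
  exact (hf.integrable (by norm_num)).mul_bdd (c := B)
    hw.aestronglyMeasurable (.of_forall hB)

lemma MemLp.mono_time {f : ℝ → ℝ → ℝ} (hf : MemLp
    (fun p : ℝ × ℝ => f p.1 p.2) 2 (volume.restrict (Ioo 0 T ×ˢ Ioo 0 Λ))) {s : ℝ} (hs : s ≤ T) :
    MemLp (fun p : ℝ × ℝ => f p.1 p.2) 2 (volume.restrict (Ioo 0 s ×ˢ Ioo 0 Λ)) :=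
  hf.mono_measure (Measure.restrict_mono (prod_mono (Ioo_subset_Ioo_right hs) le_rfl) le_rfl)

end SpaceTime

/-! ### Regularity in time of the continuous model -/

section TimeRegularity

lemma MemH1.memLp {Λ : ℝ} (hΛ : 0 ≤ Λ) {u : ℝ → ℝ} (hu : MemH1 Λ u) :
    MemLp u 2 (volume.restrict (Ioo 0 Λ)) := by
  obtain ⟨C, hC⟩ := hu.1.exists_bound
  have hc := hu.1.continuousOn
  rw [uIcc_of_le hΛ] at hC hc
  refine MemLp.of_bound ((hc.mono Ioo_subset_Icc_self).aestronglyMeasurable measurableSet_Ioo) C ?_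
  rw [ae_restrict_iff' measurableSet_Ioo]
  exact .of_forall fun y hy => hC y (Ioo_subset_Icc_self hy)

variable {P : Tail} {S : Stroke} {l₀ : ℝ → ℝ} {l g : ℝ → ℝ → ℝ} {t : ℝ}

section Basic

variable (hl : ∀ T : ℝ, 0 < T → IsWeakSolution P S l₀ T l)
include hl

lemma weak_memV {s : ℝ} (hs : 0 < s) : MemV P.Λ (l s) :=
  (hl (s + 1) (by linarith)).memV s ⟨hs, by linarith⟩

lemma weak_memH1 (hl₀ : MemH1 P.Λ l₀) {s : ℝ} (hs : 0 ≤ s) : MemH1 P.Λ (l s) := by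
  rcases hs.eq_or_lt with rfl | hs
  · exact hl₀.congr P.Λ_pos.le fun y hy => ((hl 1 one_pos).init y hy).symm
  · exact (weak_memV hl hs).1

lemma weak_tendsto_integral_mul (hl₀ : MemH1 P.Λ l₀) {v : ℝ → ℝ}
    (hv : MemLp v 2 (volume.restrict (Ioo 0 P.Λ))) :
    Tendsto (fun s => ∫ y in (0 : ℝ)..P.Λ, l s y * v y) (𝓝[>] 0)
      (𝓝 (∫ y in (0 : ℝ)..P.Λ, l₀ y * v y)) := by
  have hΛ := P.Λ_pos.le
  rw [tendsto_iff_edist_tendsto_0]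
  have h1 : Tendsto (fun s => normL2 P.Λ (fun y => l s y - l₀ y) * normL2 P.Λ v) (𝓝[>] 0) (𝓝 0) := by
    have h2 := ENNReal.Tendsto.mul_const (b := normL2 P.Λ v) (hl 1 one_pos).tendsto_init
      (.inr hv.2.ne)
    rwa [zero_mul] at h2
  refine tendsto_of_tendsto_of_tendsto_of_le_of_le' tendsto_const_nhds h1
    (.of_forall fun _ => zero_le) ?_
  filter_upwards [self_mem_nhdsWithin] with s hs
  have hls := (weak_memV hl hs).1
  rw [edist_eq_enorm_sub, ← intervalIntegral.integral_sub
    (MemLp.intervalIntegrable_mul hΛ (hls.memLp hΛ) hv)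
    (MemLp.intervalIntegrable_mul hΛ (hl₀.memLp hΛ) hv), intervalIntegral_eq_Ioo hΛ]
  refine (enorm_integral_le_lintegral_enorm _).trans ?_
  have h2 := eLpNorm_smul_le_mul_eLpNorm (p := 2) (q := 2) (r := 1) hv.1
    ((hls.sub hΛ hl₀).memLp hΛ).1
  rw [eLpNorm_one_eq_lintegral_enorm] at h2
  refine le_trans (le_of_eq ?_) h2
  refine lintegral_congr fun y => ?_
  simp only [Pi.smul_apply', smul_eq_mul]
  ring_nf

/-- The derivative of a test function is itself admissible in 𝒱 and vanishes at 0, so neither the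
load nor the boundary term of κ appears. -/
lemma weak_hasDerivAt {β : ℝ → ℝ} (hβ : IsTest 0 P.Λ β) {s : ℝ} (hs : 0 < s) :
    HasDerivAt (fun s => ∫ y in (0 : ℝ)..P.Λ, l s y * deriv β y)
      (-(P.Λ ^ 2 * P.K) * ∫ y in Ioo 0 P.Λ, deriv (l s) y * deriv (deriv β) y) s := by
  have h := (hl (s + 1) (by linarith)).eqn s ⟨hs, by linarith⟩ (deriv β) hβ.deriv.memV
  convert! h using 1
  rw [kappa, hβ.deriv.eq_zero (y := 0) (by simp), intervalIntegral_eq_Ioo P.Λ_pos.le]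
  ring

lemma weak_continuousOn (hl₀ : MemH1 P.Λ l₀) {β : ℝ → ℝ} (hβ : IsTest 0 P.Λ β) :
    ContinuousOn (fun s => ∫ y in (0 : ℝ)..P.Λ, l s y * deriv β y) (Ici 0) := by
  intro s hs
  rcases (mem_Ici.1 hs).eq_or_lt with rfl | hs
  · rw [← continuousWithinAt_Ioi_iff_Ici]
    have h := weak_tendsto_integral_mul hl hl₀ (v := deriv β) hβ.deriv.memLp
    have e : ∫ y in (0 : ℝ)..P.Λ, l 0 y * deriv β y = ∫ y in (0 : ℝ)..P.Λ, l₀ y * deriv β y := by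
      refine intervalIntegral.integral_congr fun y hy => ?_
      rw [uIcc_of_le P.Λ_pos.le] at hy
      simp only [(hl 1 one_pos).init y hy]
    rw [← e] at h
    exact h
  · exact (weak_hasDerivAt hl hβ hs).continuousAt.continuousWithinAt

end Basic

section WeakMixed

variable (hl : ∀ T : ℝ, 0 < T → IsWeakSolution P S l₀ T l) (hl₀ : MemH1 P.Λ l₀)
  (ht : 0 < t) (hgw : HasWeakDyt P.Λ t l g)
  (hg : MemLp (fun p : ℝ × ℝ => g p.1 p.2) 2 (volume.restrict (Ioo 0 t ×ˢ Ioo 0 P.Λ)))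
include hl hl₀ ht hgw hg

/-- The moment against β' has a classical time derivative by the variational equation, while the
mixed weak derivative identifies it distributionally as -∫ g β. The two agree for almost every time,
and integrating gives the identity for every s, with continuity at 0 supplied by the initial
condition. -/
lemma weak_integral_test {β : ℝ → ℝ} (hβ : IsTest 0 P.Λ β) {s : ℝ} (hs : s ∈ Icc 0 t) :
    (∫ y in (0 : ℝ)..P.Λ, l s y * deriv β y) - (∫ y in (0 : ℝ)..P.Λ, l₀ y * deriv β y) =
      -∫ r in (0 : ℝ)..s, ∫ y in Ioo 0 P.Λ, g r y * β y := by
  have hΛ := P.Λ_pos.le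
  set m : ℝ → ℝ := fun s => ∫ y in (0 : ℝ)..P.Λ, l s y * deriv β y with hm
  set D : ℝ → ℝ := fun s =>
    -(P.Λ ^ 2 * P.K) * ∫ y in Ioo 0 P.Λ, deriv (l s) y * deriv (deriv β) y with hD
  set c : ℝ → ℝ := fun s => ∫ y in Ioo 0 P.Λ, g s y * β y with hc
  obtain ⟨B, hB⟩ := hβ.exists_bound
  obtain ⟨B1, hB1⟩ := hβ.deriv.exists_bound
  obtain ⟨B2, hB2⟩ := hβ.deriv.deriv.exists_bound
  have hDi : Integrable D (volume.restrict (Ioo 0 t)) :=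
    ((integrable_mul_bounded (f := fun s y => deriv (l s) y)
      (w := fun p => deriv (deriv β) p.2) (hl t ht).memLp_deriv
      (hβ.deriv.deriv.continuous.measurable.comp measurable_snd)
      fun p => hB2 p.2).integral_prod_left).const_mul _
  have hci : Integrable c (volume.restrict (Ioo 0 t)) :=
    (integrable_mul_bounded (w := fun p => β p.2) hg
      (hβ.continuous.measurable.comp measurable_snd) fun p => hB p.2).integral_prod_left
  have hDi' := (integrable_restrict_Ioo_iff ht.le).1 hDi
  have key : ∀ᵐ r ∂(volume.restrict (Ioo 0 t)), D r + c r = 0 := by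
    refine ae_eq_zero_of_forall_isTest (hDi.add hci) fun α hα => ?_
    obtain ⟨A, hA⟩ := hα.exists_bound
    obtain ⟨A1, hA1⟩ := hα.deriv.exists_bound
    have e := hgw.integral_eq hα hβ
    have i1 := integrable_mul_bounded (w := fun p => deriv α p.1 * deriv β p.2) (hl t ht).memLp
      ((hα.deriv.continuous.measurable.comp measurable_fst).mul
        (hβ.deriv.continuous.measurable.comp measurable_snd)) (B := A1 * B1) fun p => by
          rw [norm_mul]
          exact mul_le_mul (hA1 _) (hB1 _) (norm_nonneg _) ((norm_nonneg _).trans (hA1 0))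
    have i2 := integrable_mul_bounded (w := fun p => α p.1 * β p.2) hg
      ((hα.continuous.measurable.comp measurable_fst).mul
        (hβ.continuous.measurable.comp measurable_snd)) (B := A * B) fun p => by
          rw [norm_mul]
          exact mul_le_mul (hA _) (hB _) (norm_nonneg _) ((norm_nonneg _).trans (hA 0))
    rw [restrict_prod_eq, integral_prod _ i1, integral_prod _ i2] at e
    have e1 : ∫ s in Ioo 0 t, ∫ y in Ioo 0 P.Λ, l s y * (deriv α s * deriv β y) =
        ∫ s in (0 : ℝ)..t, m s * deriv α s := by
      rw [intervalIntegral_eq_Ioo ht.le]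
      refine integral_congr_ae (.of_forall fun r => ?_)
      simp only [hm]
      rw [intervalIntegral_eq_Ioo hΛ, ← integral_mul_const]
      exact integral_congr_ae (.of_forall fun y => by ring)
    have e2 : ∫ s in Ioo 0 t, ∫ y in Ioo 0 P.Λ, g s y * (α s * β y) =
        ∫ s in Ioo 0 t, c s * α s := by
      refine integral_congr_ae (.of_forall fun r => ?_)
      simp only [hc]
      rw [← integral_mul_const]
      exact integral_congr_ae (.of_forall fun y => by ring)
    -- Integration by parts in time; it is legitimate because m is continuous up to 0 and
    -- differentiable at every later time.
    have e3 : ∫ s in (0 : ℝ)..t, m s * deriv α s = -∫ s in Ioo 0 t, D s * α s := by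
      rw [intervalIntegral.integral_mul_deriv_eq_deriv_mul_of_hasDeriv_right
        (u := m) (u' := D) (v := α) (v' := deriv α), hα.eq_zero (y := t) (by simp),
        hα.eq_zero (y := 0) (by simp), intervalIntegral_eq_Ioo ht.le]
      · ring
      · exact (weak_continuousOn hl hl₀ hβ).mono
          (by rw [uIcc_of_le ht.le]; exact Icc_subset_Ici_self)
      · exact hα.continuous.continuousOn
      · intro x hx
        rw [min_eq_left ht.le] at hx
        exact (weak_hasDerivAt hl hβ hx.1).hasDerivWithinAt
      · intro x _
        exact ((hα.contDiff.differentiable (by norm_num)) x).hasDerivAt.hasDerivWithinAt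
      · exact hDi'
      · exact hα.deriv.continuous.intervalIntegrable _ _
    rw [e1, e2, e3] at e
    have i3 : Integrable (fun s => D s * α s) (volume.restrict (Ioo 0 t)) :=
      hDi.mul_bdd (c := A) hα.continuous.aestronglyMeasurable (.of_forall hA)
    have i4 : Integrable (fun s => c s * α s) (volume.restrict (Ioo 0 t)) :=
      hci.mul_bdd (c := A) hα.continuous.aestronglyMeasurable (.of_forall hA)
    simp_rw [add_mul]
    rw [integral_add i3 i4]
    linarith
  have e4 : ∫ r in (0 : ℝ)..s, D r = m s - m 0 := by
    refine intervalIntegral.integral_eq_sub_of_hasDerivAt_of_le hs.1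
      ((weak_continuousOn hl hl₀ hβ).mono Icc_subset_Ici_self)
      (fun x hx => weak_hasDerivAt hl hβ hx.1) (hDi'.mono_set ?_)
    rw [uIcc_of_le hs.1, uIcc_of_le ht.le]
    exact Icc_subset_Icc_right hs.2
  have e5 : m 0 = ∫ y in (0 : ℝ)..P.Λ, l₀ y * deriv β y := by
    refine intervalIntegral.integral_congr fun y hy => ?_
    rw [uIcc_of_le hΛ] at hy
    simp only [(hl 1 one_pos).init y hy]
  rw [← e5, ← e4, intervalIntegral_eq_Ioo hs.1, intervalIntegral_eq_Ioo hs.1, ← integral_neg]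
  refine integral_congr_ae ?_
  filter_upwards [ae_restrict_of_ae_restrict_of_subset (Ioo_subset_Ioo_right hs.2) key] with r hr
  linarith

/-- Integrating `weak_integral_test` by parts in y and applying Fubini tests the claim against every
β. The null set of y may depend on s, but no time s is excluded. -/
lemma weak_ae_deriv_sub {s : ℝ} (hs : s ∈ Icc 0 t) :
    ∀ᵐ y ∂(volume.restrict (Ioo 0 P.Λ)),
      deriv (l s) y - deriv l₀ y = ∫ r in Ioo 0 s, g r y := by
  have hΛ := P.Λ_pos.le
  have hls := weak_memH1 hl hl₀ hs.1
  have hgs := MemLp.mono_time hg hs.2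
  have hgi : Integrable (fun p : ℝ × ℝ => g p.1 p.2)
      ((volume.restrict (Ioo 0 s)).prod (volume.restrict (Ioo 0 P.Λ))) := by
    rw [restrict_prod_eq] at hgs
    exact hgs.integrable (by norm_num)
  have hdi : Integrable (fun y => deriv (l s) y - deriv l₀ y) (volume.restrict (Ioo 0 P.Λ)) :=
    (hls.2.sub hl₀.2).integrable (by norm_num)
  have hGi : Integrable (fun y => ∫ r in Ioo 0 s, g r y) (volume.restrict (Ioo 0 P.Λ)) :=
    hgi.integral_prod_right
  suffices h : ∀ᵐ y ∂(volume.restrict (Ioo 0 P.Λ)),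
      (deriv (l s) y - deriv l₀ y) - ∫ r in Ioo 0 s, g r y = 0 by
    filter_upwards [h] with y hy using by linarith
  refine ae_eq_zero_of_forall_isTest (hdi.sub hGi) fun β hβ => ?_
  obtain ⟨B, hB⟩ := hβ.exists_bound
  have e := weak_integral_test hl hl₀ ht hgw hg hβ hs
  have hβ0 : β 0 = 0 := hβ.eq_zero (by simp)
  have hβΛ : β P.Λ = 0 := hβ.eq_zero (by simp)
  rw [hls.1.integral_mul_deriv_eq_deriv_mul (hβ.absolutelyContinuous _ _),
    hl₀.1.integral_mul_deriv_eq_deriv_mul (hβ.absolutelyContinuous _ _), hβ0, hβΛ,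
    intervalIntegral_eq_Ioo hs.1, intervalIntegral_eq_Ioo hΛ, intervalIntegral_eq_Ioo hΛ] at e
  have i1 := integrable_mul_bounded (w := fun p => β p.2) hgs
    (hβ.continuous.measurable.comp measurable_snd) fun p => hB p.2
  rw [integral_integral_swap i1] at e
  simp_rw [integral_mul_const] at e
  have i2 : Integrable (fun y => deriv (l s) y * β y) (volume.restrict (Ioo 0 P.Λ)) :=
    hls.2.integrable_mul hβ.memLp
  have i3 : Integrable (fun y => deriv l₀ y * β y) (volume.restrict (Ioo 0 P.Λ)) :=
    hl₀.2.integrable_mul hβ.memLp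
  have i4 : Integrable (fun y => (∫ r in Ioo 0 s, g r y) * β y) (volume.restrict (Ioo 0 P.Λ)) :=
    hGi.mul_bdd (c := B) hβ.continuous.aestronglyMeasurable (.of_forall hB)
  simp_rw [sub_mul]
  have i5 : Integrable (fun y => deriv (l s) y * β y - deriv l₀ y * β y)
    (volume.restrict (Ioo 0 P.Λ)) := i2.sub i3
  rw [integral_sub i5 i4, integral_sub i2 i3]
  linarith

/-- Weighted averages of `∂_y ℓ` are absolutely continuous in time. -/
lemma weak_integral_weight {w : ℝ → ℝ} (hw : Measurable w) {B : ℝ} (hB : ∀ y, ‖w y‖ ≤ B)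
    {s : ℝ} (hs : s ∈ Icc 0 t) :
    (∫ y in Ioo 0 P.Λ, deriv (l s) y * w y) - (∫ y in Ioo 0 P.Λ, deriv l₀ y * w y) =
      ∫ r in (0 : ℝ)..s, ∫ y in Ioo 0 P.Λ, g r y * w y := by
  have hls := weak_memH1 hl hl₀ hs.1
  have hwL : MemLp w 2 (volume.restrict (Ioo 0 P.Λ)) :=
    MemLp.of_bound hw.aestronglyMeasurable B (.of_forall hB)
  have i1 := integrable_mul_bounded (w := fun p => w p.2) (MemLp.mono_time hg hs.2)
    (hw.comp measurable_snd) fun p => hB p.2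
  have i2 : Integrable (fun y => deriv (l s) y * w y) (volume.restrict (Ioo 0 P.Λ)) :=
    hls.2.integrable_mul hwL
  have i3 : Integrable (fun y => deriv l₀ y * w y) (volume.restrict (Ioo 0 P.Λ)) :=
    hl₀.2.integrable_mul hwL
  rw [intervalIntegral_eq_Ioo hs.1, integral_integral_swap i1, ← integral_sub i2 i3]
  simp_rw [integral_mul_const]
  refine integral_congr_ae ?_
  filter_upwards [weak_ae_deriv_sub hl hl₀ ht hgw hg hs] with y hy
  rw [← hy]; ring

omit hl hl₀ hgw in
lemma weak_intervalIntegrable {w : ℝ → ℝ} (hw : Measurable w) {B : ℝ} (hB : ∀ y, ‖w y‖ ≤ B) :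
    IntervalIntegrable (fun r => ∫ y in Ioo 0 P.Λ, g r y * w y) volume 0 t :=
  (integrable_restrict_Ioo_iff ht.le).1 (integrable_mul_bounded (w := fun p => w p.2) hg
    (hw.comp measurable_snd) fun p => hB p.2).integral_prod_left

end WeakMixed

end TimeRegularity

/-! ### The quadrature kernels of the lumped mass matrix -/

section Kernels

variable (P : Tail) {N : ℕ}

/-- The primitive of a hat function. -/
def hatPrim (P : Tail) (N j : ℕ) (z : ℝ) : ℝ := ∫ y in (0 : ℝ)..z, hat P N j y

/-- The Peano kernel of the quadrature error `∫ u Φ_j - h u(y_j)` for functions `u` that vanish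
at `Λ`. -/
def peano (P : Tail) (N j : ℕ) (z : ℝ) : ℝ :=
  hatPrim P N j z - P.h N * (Ioi (node P N j)).indicator (fun _ => 1) z

variable {P}

lemma integral_mul_continuous {Λ : ℝ} {u φ : ℝ → ℝ} (hΛ : 0 ≤ Λ) (hu : MemH1 Λ u)
    (hφ : Continuous φ) :
    ∫ y in (0 : ℝ)..Λ, u y * φ y = u Λ * (∫ x in (0 : ℝ)..Λ, φ x) -
      ∫ y in Ioo 0 Λ, deriv u y * ∫ x in (0 : ℝ)..y, φ x := by
  have h := hu.1.integral_mul_deriv_eq_deriv_mul (g := fun y => ∫ x in (0 : ℝ)..y, φ x)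
    ((hφ.intervalIntegrable 0 Λ).absolutelyContinuousOnInterval_intervalIntegral (by simp))
  simp only [hφ.deriv_integral, intervalIntegral.integral_same, mul_zero, sub_zero] at h
  rw [h, intervalIntegral_eq_Ioo (u := fun y => deriv u y * _) hΛ]

lemma hat_continuous (hN : 1 ≤ N) (j : ℕ) : Continuous (hat P N j) :=
  (hat_lipschitz P hN j).continuous

lemma hatPrim_continuous (hN : 1 ≤ N) (j : ℕ) : Continuous (hatPrim P N j) :=
  intervalIntegral.continuous_primitive
    (fun a b => (hat_continuous hN j).intervalIntegrable a b) 0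

/-- Together with `MemV.apply_node` this represents the lumping defect: ∫ u Φ_j - h u(y_j) = -∫ u' ·
`peano`. -/
lemma MemV.integral_mul_hat (hN : 1 ≤ N) {u : ℝ → ℝ} (hu : MemV P.Λ u) (j : ℕ) :
    ∫ y in (0 : ℝ)..P.Λ, u y * hat P N j y = -∫ y in Ioo 0 P.Λ, deriv u y * hatPrim P N j y := by
  rw [integral_mul_continuous P.Λ_pos.le hu.1 (hat_continuous hN j), hu.2]
  simp [hatPrim]

lemma MemV.apply_node (hN : 1 ≤ N) {u : ℝ → ℝ} (hu : MemV P.Λ u) {j : ℕ} (hj : j ≤ N) :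
    u (node P N j) =
      -∫ y in Ioo 0 P.Λ, deriv u y * (Ioi (node P N j)).indicator (fun _ => 1) y := by
  have hm := node_mem_Icc P hN hj
  have hac : AbsolutelyContinuousOnInterval u (node P N j) P.Λ := hu.1.1.mono (by
    rw [uIcc_of_le P.Λ_pos.le, uIcc_of_le hm.2]; exact Icc_subset_Icc_left hm.1)
  have h := hac.integral_deriv_eq_sub
  rw [hu.2, zero_sub, intervalIntegral_eq_Ioo hm.2] at h
  rw [← neg_eq_iff_eq_neg, ← h]
  have e : ∀ y, deriv u y * (Ioi (node P N j)).indicator (fun _ => 1) y =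
      (Ioi (node P N j)).indicator (deriv u) y := by
    intro y; by_cases hy : y ∈ Ioi (node P N j) <;> simp [hy]
  simp_rw [e]
  rw [setIntegral_indicator measurableSet_Ioi]
  congr 2
  ext y
  simp only [mem_Ioo, mem_inter_iff, mem_Ioi]
  exact ⟨fun h => ⟨⟨hm.1.trans_lt h.1, h.2⟩, h.1⟩, fun h => ⟨h.2, h.1.2⟩⟩

lemma MemVh.integral_eq (hN : 1 ≤ N) {v : ℝ → ℝ} (hv : MemVh P N v) :
    ∫ y in (0 : ℝ)..P.Λ, v y =
      ∑ k ∈ Finset.range N, P.h N * (v (node P N k) + v (node P N (k + 1))) / 2 := by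
  have hh := P.h_pos hN
  have hi : IntervalIntegrable v volume 0 P.Λ :=
    (hv.absolutelyContinuous hN).continuousOn.intervalIntegrable
  rw [← sum_integral_elements P hN hi]
  refine Finset.sum_congr rfl fun k hk => ?_
  have hk := Finset.mem_range.1 hk
  rw [intervalIntegral.integral_congr (g := fun y => v (node P N k) +
      (v (node P N (k + 1)) - v (node P N k)) / P.h N * (y - node P N k))]
  · rw [intervalIntegral.integral_add (by simp) (by
      exact (Continuous.intervalIntegrable (by fun_prop) _ _)),
      intervalIntegral.integral_const, intervalIntegral.integral_const_mul,
      intervalIntegral.integral_sub (by simp) (by simp), integral_id,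
      intervalIntegral.integral_const, smul_eq_mul, smul_eq_mul, node_succ]
    field_simp
    ring
  · intro y hy
    rw [uIcc_of_le (node_lt_succ P hN k).le] at hy
    exact hv.eq_on_element hN hk hy

/-- Only half of the hat at the node 0 lies in the interval. The lumped weight h is thus exact on
constants at every node except that one. -/
lemma integral_hat (hN : 1 ≤ N) {j : ℕ} (hj : j < N) :
    ∫ y in (0 : ℝ)..P.Λ, hat P N j y = P.h N * (1 + if j = 0 then 0 else 1) / 2 := by
  rw [(hat_memVh P hN hj).integral_eq hN]
  simp_rw [hat_node P hN]
  rw [← Finset.sum_div, ← Finset.mul_sum, Finset.sum_add_distrib, Finset.sum_ite_eq,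
    if_pos (Finset.mem_range.2 hj)]
  congr 3
  split_ifs with h
  · exact Finset.sum_eq_zero fun k _ => if_neg (by omega)
  · rw [Finset.sum_eq_single_of_mem (j - 1) (Finset.mem_range.2 (by omega)), if_pos (by omega)]
    intro k _ hk
    exact if_neg (by omega)

lemma hatPrim_mem (hN : 1 ≤ N) (j : ℕ) {z : ℝ} (hz : z ∈ Icc 0 P.Λ) :
    0 ≤ hatPrim P N j z ∧ hatPrim P N j z ≤ ∫ y in (0 : ℝ)..P.Λ, hat P N j y := by
  have hi := fun a b => (hat_continuous (P := P) hN j).intervalIntegrable (μ := volume) a b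
  refine ⟨intervalIntegral.integral_nonneg hz.1 fun y _ => hat_nonneg P j y, ?_⟩
  rw [← intervalIntegral.integral_add_adjacent_intervals (hi 0 z) (hi z P.Λ), hatPrim]
  linarith [intervalIntegral.integral_nonneg (μ := volume) hz.2 fun y _ => hat_nonneg P (N := N) j y]

lemma integral_hat_le (hN : 1 ≤ N) {j : ℕ} (hj : j < N) :
    ∫ y in (0 : ℝ)..P.Λ, hat P N j y ≤ P.h N := by
  have := P.h_pos hN
  rw [integral_hat hN hj]
  split_ifs <;> linarith

lemma abs_peano_le (hN : 1 ≤ N) {j : ℕ} (hj : j < N) {z : ℝ} (hz : z ∈ Icc 0 P.Λ) :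
    |peano P N j z| ≤ P.h N := by
  have := P.h_pos hN
  have h1 := hatPrim_mem (P := P) hN j hz
  have h2 := integral_hat_le (P := P) hN hj
  rw [abs_le, peano]
  by_cases h : z ∈ Ioi (node P N j)
  · rw [indicator_of_mem h]; constructor <;> linarith
  · rw [indicator_of_notMem h]; constructor <;> linarith

/-- To the left of the support of the hat both terms vanish; to the right the primitive has reached
its full mass h and cancels the jump. For j = 0 it reaches only h/2, and the kernel keeps the value
-h/2. -/
lemma peano_eq_zero (hN : 1 ≤ N) {j : ℕ} (hj : j < N) (hj0 : j ≠ 0) {z : ℝ} (hz : z ∈ Icc 0 P.Λ)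
    (h : P.h N ≤ |z - node P N j|) : peano P N j z = 0 := by
  have hh := P.h_pos hN
  have hi := fun a b => (hat_continuous (P := P) hN j).intervalIntegrable (μ := volume) a b
  rw [peano]
  rcases le_abs.1 h with h | h
  · rw [indicator_of_mem (by rw [mem_Ioi]; linarith)]
    have h1 := integral_hat (P := P) hN hj
    rw [if_neg hj0, ← intervalIntegral.integral_add_adjacent_intervals (hi 0 z) (hi z P.Λ)] at h1
    have h2 : ∫ y in z..P.Λ, hat P N j y = 0 := by
      rw [intervalIntegral.integral_congr (g := fun _ => 0)]
      · simp
      · intro y hy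
        rw [uIcc_of_le hz.2] at hy
        exact hat_eq_zero P hN (le_trans (by linarith [hy.1]) (le_abs_self _))
    rw [hatPrim]; linarith
  · rw [indicator_of_notMem (by rw [mem_Ioi]; linarith)]
    have h2 : ∫ y in (0 : ℝ)..z, hat P N j y = 0 := by
      rw [intervalIntegral.integral_congr (g := fun _ => 0)]
      · simp
      · intro y hy
        rw [uIcc_of_le hz.1] at hy
        exact hat_eq_zero P hN (le_trans (by linarith [hy.2]) (neg_le_abs _))
    rw [hatPrim, h2]; simp

/-- For z in the k-th element only the kernels of the nodes 0, k and k + 1 can be nonzero, each of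
size at most h. -/
lemma sum_abs_peano_le (hN : 1 ≤ N) {z : ℝ} (hz : z ∈ Icc 0 P.Λ) :
    ∑ j : Fin N, |peano P N j z| ≤ 3 * P.h N := by
  have hh := P.h_pos hN
  obtain ⟨k, hk, hzk⟩ := exists_mem_element P hN hz
  have key : ∀ j : Fin N, |peano P N j z| ≤ (if (j : ℕ) = 0 then P.h N else 0) +
      (if (j : ℕ) = k then P.h N else 0) + (if (j : ℕ) = k + 1 then P.h N else 0) := by
    intro j
    by_cases h0 : (j : ℕ) = 0
    · refine (abs_peano_le hN j.2 hz).trans ?_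
      rw [if_pos h0]; split_ifs <;> linarith
    by_cases h1 : (j : ℕ) = k
    · refine (abs_peano_le hN j.2 hz).trans ?_
      rw [if_pos h1, if_neg h0]; split_ifs <;> linarith
    by_cases h2 : (j : ℕ) = k + 1
    · refine (abs_peano_le hN j.2 hz).trans ?_
      rw [if_pos h2, if_neg h0, if_neg h1]; linarith
    rw [peano_eq_zero hN j.2 h0 hz]
    · simp [h0, h1, h2]
    rcases lt_or_gt_of_ne h1 with h | h
    · have h3 := node_mono P hN (Nat.succ_le_of_lt h)
      rw [Nat.succ_eq_add_one, node_succ] at h3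
      exact le_trans (by linarith [hzk.1]) (le_abs_self _)
    · have h3 := node_mono P hN (show k + 1 + 1 ≤ (j : ℕ) by omega)
      rw [node_succ] at h3
      exact le_trans (by linarith [hzk.2]) (neg_le_abs _)
  have count : ∀ m : ℕ, ∑ j : Fin N, (if (j : ℕ) = m then P.h N else 0) ≤ P.h N := by
    intro m
    rw [Fin.sum_univ_eq_sum_range (fun j => if j = m then P.h N else 0), Finset.sum_ite_eq']
    split_ifs <;> linarith
  refine (Finset.sum_le_sum fun j _ => key j).trans ?_
  rw [Finset.sum_add_distrib, Finset.sum_add_distrib]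
  linarith [count 0, count k, count (k + 1)]

lemma peano_measurable (hN : 1 ≤ N) (j : ℕ) : Measurable (peano P N j) :=
  (hatPrim_continuous hN j).measurable.sub
    ((measurable_const.indicator measurableSet_Ioi).const_mul _)

/-- The quadrature error of the lumped mass matrix, in terms of `‖∂_y u‖²`. -/
lemma sum_sq_integral_peano_le (hN : 1 ≤ N) {f : ℝ → ℝ}
    (hf : MemLp f 2 (volume.restrict (Ioo 0 P.Λ))) :
    ∑ j : Fin N, (∫ y in Ioo 0 P.Λ, f y * peano P N j y) ^ 2 ≤
      3 * P.h N ^ 2 * P.Λ * ∫ y in Ioo 0 P.Λ, f y ^ 2 := by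
  have hh := P.h_pos hN
  have hΛ := P.Λ_pos
  have hbd : ∀ j : Fin N, ∀ᵐ y ∂(volume.restrict (Ioo 0 P.Λ)), ‖|peano P N j y|‖ ≤ P.h N := by
    intro j
    rw [ae_restrict_iff' measurableSet_Ioo]
    exact .of_forall fun y hy => by
      simpa using abs_peano_le (P := P) hN j.2 (Ioo_subset_Icc_self hy)
  have hm : ∀ j : Fin N, AEStronglyMeasurable (fun y => |peano P N j y|)
      (volume.restrict (Ioo 0 P.Λ)) := fun j =>
    (peano_measurable (P := P) hN j).abs.aestronglyMeasurable
  have hi0 : ∀ j : Fin N, Integrable (fun y => |peano P N j y|) (volume.restrict (Ioo 0 P.Λ)) :=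
    fun j => Integrable.of_bound (hm j) _ (hbd j)
  have hi1 : ∀ j : Fin N, Integrable (fun y => |peano P N j y| * |f y|)
      (volume.restrict (Ioo 0 P.Λ)) := fun j =>
    (hf.integrable (by norm_num)).abs.bdd_mul (hm j) (hbd j)
  have hi2 : ∀ j : Fin N, Integrable (fun y => |peano P N j y| * |f y| ^ 2)
      (volume.restrict (Ioo 0 P.Λ)) := fun j => by
    simp_rw [sq_abs]
    exact hf.integrable_sq.bdd_mul (hm j) (hbd j)
  -- Cauchy–Schwarz with the kernel as weight leaves one kernel factor next to f², so the sum over j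
  -- can be taken pointwise in y. The crude mass bound h Λ has the right order for j = 0.
  have key : ∀ j : Fin N, (∫ y in Ioo 0 P.Λ, f y * peano P N j y) ^ 2 ≤
      P.h N * P.Λ * ∫ y in Ioo 0 P.Λ, |peano P N j y| * |f y| ^ 2 := by
    intro j
    have h1 : |∫ y in Ioo 0 P.Λ, f y * peano P N j y| ≤
        ∫ y in Ioo 0 P.Λ, |peano P N j y| * |f y| := by
      refine (abs_integral_le_integral_abs).trans (le_of_eq ?_)
      exact integral_congr_ae (.of_forall fun y => by simp only [abs_mul]; ring)
    have h2 := sq_integral_mul_le (hi0 j) (hi1 j) (hi2 j) (.of_forall fun y => abs_nonneg _)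
    have h3 : ∫ y in Ioo 0 P.Λ, |peano P N j y| ≤ P.h N * P.Λ := by
      have := setIntegral_mono_on (hi0 j) (integrable_const (P.h N)) measurableSet_Ioo
        fun y hy => abs_peano_le (P := P) hN j.2 (Ioo_subset_Icc_self hy)
      refine this.trans (le_of_eq ?_)
      simp [hΛ.le, mul_comm]
    calc _ = |∫ y in Ioo 0 P.Λ, f y * peano P N j y| ^ 2 := (sq_abs _).symm
      _ ≤ (∫ y in Ioo 0 P.Λ, |peano P N j y| * |f y|) ^ 2 := by gcongr
      _ ≤ _ := h2
      _ ≤ _ := by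
        refine mul_le_mul_of_nonneg_right h3 (integral_nonneg fun y => by positivity)
  refine (Finset.sum_le_sum fun j _ => key j).trans ?_
  rw [← Finset.mul_sum, ← integral_finsetSum _ fun j _ => hi2 j]
  have h4 : ∫ y in Ioo 0 P.Λ, ∑ j : Fin N, |peano P N j y| * |f y| ^ 2 ≤
      ∫ y in Ioo 0 P.Λ, 3 * P.h N * f y ^ 2 := by
    refine setIntegral_mono_on (integrable_finsetSum _ fun j _ => hi2 j)
      (hf.integrable_sq.const_mul _) measurableSet_Ioo fun y hy => ?_
    rw [← Finset.sum_mul, sq_abs]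
    exact mul_le_mul_of_nonneg_right (sum_abs_peano_le hN (Ioo_subset_Icc_self hy)) (sq_nonneg _)
  rw [integral_const_mul] at h4
  calc _ ≤ P.h N * P.Λ * (3 * P.h N * ∫ y in Ioo 0 P.Λ, f y ^ 2) := by gcongr
    _ = _ := by ring

end Kernels

/-! ### The energy estimate for the nodal error -/

section Energy

variable {P : Tail} {S : Stroke} {N : ℕ} {l₀ l₀h : ℝ → ℝ} {l lh g : ℝ → ℝ → ℝ} {t : ℝ}

lemma Stroke.continuous_deriv_L₀ : Continuous (deriv S.L₀) := by
  have h : ContDiff ℝ 1 S.L₀ := by unfold Stroke.L₀; fun_prop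
  exact h.continuous_deriv le_rfl

section Discrete

variable (hN : 1 ≤ N) (hlh : IsDiscreteSolution P S N l₀h lh)
include hN hlh

/-- The time derivative of the nodal values of the discrete solution. -/
lemma discrete_hasDerivAt (j : Fin N) {s : ℝ} (hs : 0 < s) :
    HasDerivAt (fun s => lh s (node P N j))
      ((load P S N s j - (stiffness P N).mulVec (nodal P N (lh s)) j) / P.h N) s := by
  have hh := P.h_pos hN
  have h := (hasDerivAt_pi.1 (hlh.eqn s hs) j).div_const (P.h N)
  simp only [lumpedMass, Matrix.mulVec_diagonal, Pi.sub_apply, nodal] at h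
  convert! h using 1
  funext s
  field_simp

lemma discrete_continuousOn (j : Fin N) : ContinuousOn (fun s => lh s (node P N j)) (Ici 0) := by
  intro s hs
  rcases (mem_Ici.1 hs).eq_or_lt with rfl | hs
  · exact (continuousWithinAt_pi.1 hlh.cont_init j)
  · exact (discrete_hasDerivAt hN hlh j hs).continuousAt.continuousWithinAt

lemma discrete_velocity_continuousOn (j : Fin N) :
    ContinuousOn (fun s =>
      (load P S N s j - (stiffness P N).mulVec (nodal P N (lh s)) j) / P.h N) (Ici 0) := by
  have h1 : Continuous fun s => load P S N s j := by
    unfold load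
    split_ifs
    · exact S.continuous_deriv_L₀.const_mul _
    · exact continuous_const
  refine (h1.continuousOn.sub ?_).div_const _
  simp only [Matrix.mulVec, dotProduct, nodal]
  exact continuousOn_finsetSum _ fun i _ =>
    continuousOn_const.mul (discrete_continuousOn hN hlh i)

lemma discrete_sub_eq_integral (j : Fin N) {s : ℝ} (hs : 0 ≤ s) :
    lh s (node P N j) = lh 0 (node P N j) + ∫ r in (0 : ℝ)..s,
      (load P S N r j - (stiffness P N).mulVec (nodal P N (lh r)) j) / P.h N := by
  rw [intervalIntegral.integral_eq_sub_of_hasDerivAt_of_le hs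
    ((discrete_continuousOn hN hlh j).mono Icc_subset_Ici_self)
    (fun x hx => discrete_hasDerivAt hN hlh j hx.1)]
  · ring
  · refine ((discrete_velocity_continuousOn hN hlh j).mono ?_).intervalIntegrable
    rw [uIcc_of_le hs]; exact Icc_subset_Ici_self

end Discrete

lemma hatPrim_norm_le (hN : 1 ≤ N) (j : Fin N) : ∀ y ∈ Ioo 0 P.Λ, ‖hatPrim P N j y‖ ≤ P.h N := by
  intro y hy
  have h := hatPrim_mem (P := P) hN j (Ioo_subset_Icc_self hy)
  rw [Real.norm_eq_abs, abs_of_nonneg h.1]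
  exact h.2.trans (integral_hat_le hN j.2)

section Continuous

variable (hl : ∀ T : ℝ, 0 < T → IsWeakSolution P S l₀ T l) (hl₀ : MemH1 P.Λ l₀)
  (ht : 0 < t) (hgw : HasWeakDyt P.Λ t l g)
  (hg : MemLp (fun p : ℝ × ℝ => g p.1 p.2) 2 (volume.restrict (Ioo 0 t ×ˢ Ioo 0 P.Λ)))
include hl hl₀ ht hgw hg

/-- The version of `weak_integral_weight` for weights that are bounded on `(0, Λ)`. -/
lemma weak_integral_weight_Ioo {w : ℝ → ℝ} (hw : Measurable w) {B : ℝ}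
    (hB : ∀ y ∈ Ioo 0 P.Λ, ‖w y‖ ≤ B) {s : ℝ} (hs : s ∈ Icc 0 t) :
    (∫ y in Ioo 0 P.Λ, deriv (l s) y * w y) - (∫ y in Ioo 0 P.Λ, deriv l₀ y * w y) =
      ∫ r in (0 : ℝ)..s, ∫ y in Ioo 0 P.Λ, g r y * w y := by
  have h := weak_integral_weight hl hl₀ ht hgw hg
    (hw.indicator (measurableSet_Ioo (a := (0 : ℝ)) (b := P.Λ))) (B := max B 0) (fun y => by
      by_cases hy : y ∈ Ioo 0 P.Λ
      · rw [indicator_of_mem hy]; exact (hB y hy).trans (le_max_left _ _)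
      · rw [indicator_of_notMem hy, norm_zero]; exact le_max_right _ _) hs
  have e : ∀ f : ℝ → ℝ, ∫ y in Ioo 0 P.Λ, f y * (Ioo 0 P.Λ).indicator w y =
      ∫ y in Ioo 0 P.Λ, f y * w y := fun f =>
    setIntegral_congr_fun measurableSet_Ioo fun y hy => by simp only [indicator_of_mem hy]
  simpa only [e] using h

omit hl hl₀ hgw in
lemma weak_intervalIntegrable_Ioo {w : ℝ → ℝ} (hw : Measurable w) {B : ℝ}
    (hB : ∀ y ∈ Ioo 0 P.Λ, ‖w y‖ ≤ B) :
    IntervalIntegrable (fun r => ∫ y in Ioo 0 P.Λ, g r y * w y) volume 0 t := by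
  have h := weak_intervalIntegrable ht hg
    (hw.indicator (measurableSet_Ioo (a := (0 : ℝ)) (b := P.Λ))) (B := max B 0) (fun y => by
      by_cases hy : y ∈ Ioo 0 P.Λ
      · rw [indicator_of_mem hy]; exact (hB y hy).trans (le_max_left _ _)
      · rw [indicator_of_notMem hy, norm_zero]; exact le_max_right _ _)
  have e : ∀ f : ℝ → ℝ, ∫ y in Ioo 0 P.Λ, f y * (Ioo 0 P.Λ).indicator w y =
      ∫ y in Ioo 0 P.Λ, f y * w y := fun f =>
    setIntegral_congr_fun measurableSet_Ioo fun y hy => by simp only [indicator_of_mem hy]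
  simpa only [e] using h

/-- The initial datum satisfies the Dirichlet condition. -/
lemma weak_init_memV : MemV P.Λ l₀ := by
  refine ⟨hl₀, ?_⟩
  have hΛ := P.Λ_pos
  have hB : ∀ y ∈ Ioo 0 P.Λ, ‖y‖ ≤ P.Λ := fun y hy => by
    rw [Real.norm_eq_abs, abs_of_pos hy.1]; exact hy.2.le
  -- L² convergence does not preserve boundary values. Instead, the limit of the mean of ℓ(s) is
  -- computed twice: it is ∫ ℓ_0, and also -∫ y ∂_y ℓ_0 because ℓ(s) vanishes at Λ. The discrepancy
  -- is Λ ℓ_0(Λ).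
  have h1 := weak_tendsto_integral_mul hl hl₀ (v := fun _ => 1) (memLp_const 1)
  have h2 : ∫ y in (0 : ℝ)..P.Λ, l₀ y * 1 =
      l₀ P.Λ * P.Λ - ∫ y in Ioo 0 P.Λ, deriv l₀ y * y := by
    rw [integral_mul_continuous hΛ.le hl₀ continuous_const]
    simp
  have h3 : Tendsto (fun s => -(∫ y in Ioo 0 P.Λ, deriv l₀ y * y) -
      ∫ r in (0 : ℝ)..s, ∫ y in Ioo 0 P.Λ, g r y * y) (𝓝[>] 0)
      (𝓝 (-(∫ y in Ioo 0 P.Λ, deriv l₀ y * y) - 0)) := by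
    refine tendsto_const_nhds.sub ?_
    have hac := (weak_intervalIntegrable_Ioo ht hg measurable_id
      hB).absolutelyContinuousOnInterval_intervalIntegral (c := 0) (by simp)
    have hc := hac.continuousOn 0 (by simp)
    rw [uIcc_of_le ht.le] at hc
    have hc' : ContinuousWithinAt
      (fun s => ∫ r in (0 : ℝ)..s, ∫ y in Ioo 0 P.Λ, g r y * id y) (Ioi 0) 0 :=
      hc.mono_of_mem_nhdsWithin (Icc_mem_nhdsGT ht)
    simpa [ContinuousWithinAt] using hc'
  have h4 : Tendsto (fun s => ∫ y in (0 : ℝ)..P.Λ, l s y * 1) (𝓝[>] 0)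
      (𝓝 (-(∫ y in Ioo 0 P.Λ, deriv l₀ y * y) - 0)) := by
    refine h3.congr' ?_
    filter_upwards [Ioc_mem_nhdsGT ht] with s hs
    have hV := weak_memV hl hs.1
    have h := weak_integral_weight_Ioo hl hl₀ ht hgw hg measurable_id hB ⟨hs.1.le, hs.2⟩
    simp only [id] at h
    rw [integral_mul_continuous hΛ.le hV.1 continuous_const, hV.2, ← h]
    simp only [intervalIntegral.integral_const, sub_zero, smul_eq_mul, mul_one, zero_mul, zero_sub]
    ring
  have h5 := tendsto_nhds_unique h1 h4
  have h6 : l₀ P.Λ * P.Λ = 0 := by linarith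
  exact (mul_eq_zero.1 h6).resolve_right hΛ.ne'

lemma weak_memV_Icc {s : ℝ} (hs : 0 ≤ s) : MemV P.Λ (l s) := by
  rcases hs.eq_or_lt with rfl | hs
  · refine ⟨weak_memH1 hl hl₀ le_rfl, ?_⟩
    rw [(hl 1 one_pos).init _ ⟨P.Λ_pos.le, le_rfl⟩, (weak_init_memV hl hl₀ ht hgw hg).2]
  · exact weak_memV hl hs

lemma weak_node_eq (hN : 1 ≤ N) (j : Fin N) {s : ℝ} (hs : s ∈ Icc 0 t) :
    l s (node P N j) = l₀ (node P N j) - ∫ r in (0 : ℝ)..s, ∫ y in Ioo 0 P.Λ,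
      g r y * (Ioi (node P N j)).indicator (fun _ => 1) y := by
  rw [(weak_memV_Icc hl hl₀ ht hgw hg hs.1).apply_node hN j.2.le,
    (weak_init_memV hl hl₀ ht hgw hg).apply_node hN j.2.le,
    ← weak_integral_weight_Ioo hl hl₀ ht hgw hg (measurable_const.indicator measurableSet_Ioi)
      (B := 1) (fun y _ => by by_cases hy : y ∈ Ioi (node P N j) <;> simp [hy]) hs]
  ring

lemma weak_moment_eq (hN : 1 ≤ N) (j : Fin N) {s : ℝ} (hs : s ∈ Icc 0 t) :
    ∫ y in (0 : ℝ)..P.Λ, l s y * hat P N j y = (∫ y in (0 : ℝ)..P.Λ, l₀ y * hat P N j y) +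
      ∫ r in (0 : ℝ)..s, -∫ y in Ioo 0 P.Λ, g r y * hatPrim P N j y := by
  rw [(weak_memV_Icc hl hl₀ ht hgw hg hs.1).integral_mul_hat hN,
    (weak_init_memV hl hl₀ ht hgw hg).integral_mul_hat hN, intervalIntegral.integral_neg,
    ← weak_integral_weight_Ioo hl hl₀ ht hgw hg (hatPrim_continuous hN j).measurable
      (hatPrim_norm_le hN j) hs]
  ring

omit hl₀ ht hgw hg in
-- The equation tested with Φ_j. Comparison with the derivative given by `weak_moment_eq` eliminates
-- the load.
lemma weak_moment_hasDerivAt (hN : 1 ≤ N) (j : Fin N) {s : ℝ} (hs : 0 < s) :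
    HasDerivAt (fun s => ∫ y in (0 : ℝ)..P.Λ, l s y * hat P N j y)
      (load P S N s j - (stiffness P N).mulVec (nodal P N (l s)) j) s := by
  have h := (hl (s + 1) (by linarith)).eqn s ⟨hs, by linarith⟩ _ ((hat_memVh P hN j.2).memV hN)
  convert! h using 1
  rw [stiffness_mulVec_nodal P hN (weak_memV hl hs), load]
  have := hat_node P hN j 0
  rw [node_zero] at this
  rw [this]
  split_ifs <;> ring

end Continuous

lemma ae_hasDerivAt_of_eq_integral {u p : ℝ → ℝ} {c : ℝ}
    (hp : IntervalIntegrable p volume 0 t)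
    (hu : ∀ s ∈ Icc 0 t, u s = c + ∫ r in (0 : ℝ)..s, p r) :
    ∀ᵐ s ∂(volume.restrict (Ioo 0 t)), HasDerivAt u (p s) s := by
  rw [ae_restrict_iff' measurableSet_Ioo]
  filter_upwards [hp.ae_hasDerivAt_integral] with s h hs
  have ht : 0 ≤ t := (hs.1.trans hs.2).le
  have := (h (by rw [uIcc_of_le ht]; exact Ioo_subset_Icc_self hs) 0 (by simp)).const_add c
  refine this.congr_of_eventuallyEq ?_
  filter_upwards [isOpen_Ioo.mem_nhds hs] with r hr using hu r (Ioo_subset_Icc_self hr)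

lemma absolutelyContinuous_of_eq_integral (ht : 0 ≤ t) {u p : ℝ → ℝ} {c : ℝ}
    (hp : IntervalIntegrable p volume 0 t)
    (hu : ∀ s ∈ Icc 0 t, u s = c + ∫ r in (0 : ℝ)..s, p r) :
    AbsolutelyContinuousOnInterval u 0 t := by
  refine absolutelyContinuousOnInterval_congr ((absolutelyContinuousOnInterval_const c).add
    (hp.absolutelyContinuousOnInterval_intervalIntegral (c := 0) (by simp))) ?_
  rw [uIcc_of_le ht]
  exact fun s hs => (hu s hs).symm

/-- The energy of the nodal error `ℓ_h(t) - I_h ℓ(t)`. -/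
lemma energy_le (hN : 1 ≤ N) (hlh : IsDiscreteSolution P S N l₀h lh)
    (hl : ∀ T : ℝ, 0 < T → IsWeakSolution P S l₀ T l) (hl₀ : MemH1 P.Λ l₀)
    (ht : 0 < t) (hgw : HasWeakDyt P.Λ t l g)
    (hg : MemLp (fun p : ℝ × ℝ => g p.1 p.2) 2 (volume.restrict (Ioo 0 t ×ˢ Ioo 0 P.Λ)))
    (e : ℝ → Fin N → ℝ) (he : ∀ s j, e s j = lh s (node P N j) - l s (node P N j)) :
    ∑ i, e t i * (stiffness P N).mulVec (e t) i ≤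
      ∑ i, e 0 i * (stiffness P N).mulVec (e 0) i +
        3 / 2 * P.h N * P.Λ * ∫ p in Ioo 0 t ×ˢ Ioo 0 P.Λ, g p.1 p.2 ^ 2 := by
  have hh := P.h_pos hN
  set K := stiffness P N with hK
  set χ : Fin N → ℝ → ℝ := fun j => (Ioi (node P N j)).indicator fun _ => 1 with hχ
  -- The time derivative of e_j: the discrete velocity minus ∂_t ℓ(y_j), the latter being -∫ g χ_j
  -- since ℓ vanishes at Λ.
  set p : Fin N → ℝ → ℝ := fun j r => (load P S N r j - K.mulVec (nodal P N (lh r)) j) / P.h N +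
    ∫ y in Ioo 0 P.Λ, g r y * χ j y with hp
  have hχm : ∀ j, Measurable (χ j) := fun j => measurable_const.indicator measurableSet_Ioi
  have hχB : ∀ j, ∀ y ∈ Ioo 0 P.Λ, ‖χ j y‖ ≤ 1 := fun j y _ => by
    by_cases hy : y ∈ Ioi (node P N j) <;> simp [hχ, hy]
  have hGi : ∀ j, IntervalIntegrable (fun r => ∫ y in Ioo 0 P.Λ, g r y * χ j y) volume 0 t :=
    fun j => weak_intervalIntegrable_Ioo ht hg (hχm j) (hχB j)
  have hvi : ∀ j, ∀ s ∈ Icc 0 t, IntervalIntegrable (fun r =>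
      (load P S N r j - K.mulVec (nodal P N (lh r)) j) / P.h N) volume 0 s := fun j s hs =>
    ((discrete_velocity_continuousOn hN hlh j).mono
      (by rw [uIcc_of_le hs.1]; exact Icc_subset_Ici_self)).intervalIntegrable
  have hpi : ∀ j, IntervalIntegrable (p j) volume 0 t := fun j =>
    (hvi j t ⟨ht.le, le_rfl⟩).add (hGi j)
  have hep : ∀ j, ∀ s ∈ Icc 0 t, e s j = e 0 j + ∫ r in (0 : ℝ)..s, p j r := by
    intro j s hs
    have hGi' := (hGi j).mono_set (by
      rw [uIcc_of_le hs.1, uIcc_of_le ht.le]; exact Icc_subset_Icc_right hs.2 :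
        uIcc 0 s ⊆ uIcc 0 t)
    rw [he, he, discrete_sub_eq_integral hN hlh j hs.1, weak_node_eq hl hl₀ ht hgw hg hN j hs,
      weak_node_eq hl hl₀ ht hgw hg hN j ⟨le_rfl, ht.le⟩,
      intervalIntegral.integral_add (hvi j s hs) hGi', intervalIntegral.integral_same]
    ring
  have hac : ∀ j, AbsolutelyContinuousOnInterval (fun s => e s j) 0 t := fun j =>
    absolutelyContinuous_of_eq_integral ht.le (hpi j) (hep j)
  have hΨi : ∀ j : Fin N, IntervalIntegrable
      (fun r => ∫ y in Ioo 0 P.Λ, g r y * hatPrim P N j y) volume 0 t := fun j =>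
    weak_intervalIntegrable_Ioo ht hg (hatPrim_continuous hN j).measurable
      (hatPrim_norm_le hN j)
  set E : ℝ → ℝ := fun s => ∑ i, e s i * K.mulVec (e s) i with hE
  have hKac : ∀ i, AbsolutelyContinuousOnInterval (fun s => K.mulVec (e s) i) 0 t := by
    intro i
    simp only [Matrix.mulVec, dotProduct]
    exact absolutelyContinuousOnInterval_sum (f := fun j s => K i j * e s j) _
      fun j _ => (hac j).const_mul (K i j)
  have hEac : AbsolutelyContinuousOnInterval E 0 t :=
    absolutelyContinuousOnInterval_sum (f := fun i s => e s i * K.mulVec (e s) i) _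
      fun i _ => (hac i).fun_mul (hKac i)
  have hg' := hg
  rw [restrict_prod_eq] at hg'
  have hQ : Integrable (fun r => ∫ y in Ioo 0 P.Λ, g r y ^ 2) (volume.restrict (Ioo 0 t)) :=
    hg'.integrable_sq.integral_prod_left
  have key : ∀ᵐ r ∂(volume.restrict (Ioo 0 t)),
      deriv E r ≤ 3 / 2 * P.h N * P.Λ * ∫ y in Ioo 0 P.Λ, g r y ^ 2 := by
    have a1 : ∀ᵐ r ∂(volume.restrict (Ioo 0 t)), ∀ j, HasDerivAt (fun s => e s j) (p j r) r :=
      ae_all_iff.2 fun j => ae_hasDerivAt_of_eq_integral (hpi j) (hep j)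
    have a2 : ∀ᵐ r ∂(volume.restrict (Ioo 0 t)), ∀ j : Fin N,
        HasDerivAt (fun s => ∫ y in (0 : ℝ)..P.Λ, l s y * hat P N j y)
          (-∫ y in Ioo 0 P.Λ, g r y * hatPrim P N j y) r :=
      ae_all_iff.2 fun j => ae_hasDerivAt_of_eq_integral (hΨi j).neg
        fun s hs => weak_moment_eq hl hl₀ ht hgw hg hN j hs
    have a3 : ∀ᵐ r ∂(volume.restrict (Ioo 0 t)),
        MemLp (g r) 2 (volume.restrict (Ioo 0 P.Λ)) := by
      filter_upwards [hg'.integrable_sq.prod_right_ae, hg'.1.prodMk_left] with r h1 h2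
      exact (memLp_two_iff_integrable_sq h2).2 h1
    filter_upwards [a1, a2, a3, self_mem_ae_restrict measurableSet_Ioo] with r h1 h2 h3 hr
    set R : Fin N → ℝ := fun j => ∫ y in Ioo 0 P.Λ, g r y * peano P N j y with hR
    -- The error equation h e' + K e = -R, obtained by equating the two derivatives of the moment ∫
    -- ℓ Φ_j.
    have hKe : ∀ j, K.mulVec (e r) j = -R j - P.h N * p j r := by
      intro j
      have b1 := (weak_moment_hasDerivAt hl hN j hr.1).unique (h2 j)
      have b2 : e r = nodal P N (lh r) - nodal P N (l r) := funext fun j => he r j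
      have m1 : MemLp (hatPrim P N j) 2 (volume.restrict (Ioo 0 P.Λ)) :=
        MemLp.of_bound (hatPrim_continuous hN j).aestronglyMeasurable (P.h N) (by
          rw [ae_restrict_iff' measurableSet_Ioo]
          exact .of_forall (hatPrim_norm_le hN j))
      have m2 : MemLp (χ j) 2 (volume.restrict (Ioo 0 P.Λ)) :=
        MemLp.of_bound (hχm j).aestronglyMeasurable 1 (by
          rw [ae_restrict_iff' measurableSet_Ioo]
          exact .of_forall (hχB j))
      have i1 : Integrable (fun y => g r y * hatPrim P N j y) (volume.restrict (Ioo 0 P.Λ)) :=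
        h3.integrable_mul m1
      have i2 : Integrable (fun y => g r y * χ j y) (volume.restrict (Ioo 0 P.Λ)) :=
        h3.integrable_mul m2
      have b3 : R j = (∫ y in Ioo 0 P.Λ, g r y * hatPrim P N j y) -
          P.h N * ∫ y in Ioo 0 P.Λ, g r y * χ j y := by
        rw [← integral_const_mul, ← integral_sub i1 (i2.const_mul _)]
        exact integral_congr_ae (.of_forall fun y => by simp only [peano, hχ]; ring)
      rw [b2, Matrix.mulVec_sub, Pi.sub_apply, b3, hp]
      field_simp
      linarith
    have hdE : HasDerivAt E (∑ i, (p i r * K.mulVec (e r) i +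
        e r i * K.mulVec (fun j => p j r) i)) r := by
      refine HasDerivAt.fun_sum fun i _ => (h1 i).mul ?_
      simp only [Matrix.mulVec, dotProduct]
      exact HasDerivAt.fun_sum fun j _ => (h1 j).const_mul (K i j)
    have hsymm : ∑ i, e r i * K.mulVec (fun j => p j r) i = ∑ i, p i r * K.mulVec (e r) i := by
      simp only [Matrix.mulVec, dotProduct, Finset.mul_sum]
      rw [Finset.sum_comm]
      refine Finset.sum_congr rfl fun i _ => Finset.sum_congr rfl fun j _ => ?_
      rw [hK, stiffness_symm]; ring
    rw [hdE.deriv, Finset.sum_add_distrib, hsymm, ← two_mul, Finset.mul_sum]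
    have b4 := sum_sq_integral_peano_le (P := P) hN h3
    -- By the error equation this is (R + 2 h p)² ≥ 0. The division by h here lowers the h² of the
    -- quadrature bound to h.
    have b5 : ∀ i, 2 * (p i r * K.mulVec (e r) i) ≤ R i ^ 2 / (2 * P.h N) := by
      intro i
      rw [hKe, le_div_iff₀ (by positivity)]
      nlinarith [sq_nonneg (R i + 2 * P.h N * p i r)]
    refine (Finset.sum_le_sum fun i _ => b5 i).trans ?_
    rw [← Finset.sum_div, div_le_iff₀ (by positivity)]
    refine b4.trans (le_of_eq ?_)
    ring
  have h1 := hEac.integral_deriv_eq_sub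
  rw [intervalIntegral_eq_Ioo ht.le] at h1
  have h2 := integral_mono_ae ((integrable_restrict_Ioo_iff ht.le).2 hEac.intervalIntegrable_deriv)
    (hQ.const_mul (3 / 2 * P.h N * P.Λ)) key
  rw [integral_const_mul, h1] at h2
  rw [restrict_prod_eq, integral_prod _ hg'.integrable_sq]
  simp only [hE] at h2
  linarith

end Energy

/-! ### The error estimate -/

section ErrorEstimate

variable {P : Tail} {S : Stroke} {N : ℕ} {l₀ l₀h : ℝ → ℝ} {l lh g : ℝ → ℝ → ℝ} {t : ℝ}

lemma interp_sub (x x' : Fin N → ℝ) (y : ℝ) :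
    interp P (fun j => x j - x' j) y = interp P x y - interp P x' y := by
  simp only [interp, sub_mul, Finset.sum_sub_distrib]

lemma MemV.sub {Λ : ℝ} (hΛ : 0 ≤ Λ) {u v : ℝ → ℝ} (hu : MemV Λ u) (hv : MemV Λ v) :
    MemV Λ (fun y => u y - v y) :=
  ⟨hu.1.sub hΛ hv.1, by simp [hu.2, hv.2]⟩

/-- The energy at time t dominates Λ² K times the squared seminorm, and the initial energy is at
most (Λ² K + Λ · `bdry`) times that of ℓ_{0,h} - ℓ_0. Dividing by Λ² K gives the constants. -/
lemma sqrt_integral_deriv_error_le (hN : 1 ≤ N) (hlh : IsDiscreteSolution P S N l₀h lh)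
    (hl : ∀ T : ℝ, 0 < T → IsWeakSolution P S l₀ T l) (hl₀ : MemH1 P.Λ l₀)
    (ht : 0 < t) (hgw : HasWeakDyt P.Λ t l g)
    (hg : MemLp (fun p : ℝ × ℝ => g p.1 p.2) 2 (volume.restrict (Ioo 0 t ×ˢ Ioo 0 P.Λ))) :
    √(∫ y in (0 : ℝ)..P.Λ, deriv (interp P (nodal P N fun y => lh t y - l t y)) y ^ 2) ≤
      √(1 + P.bdry / (P.Λ * P.K)) * √(∫ y in (0 : ℝ)..P.Λ, deriv (fun y => l₀h y - l₀ y) y ^ 2) +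
        √(3 / (2 * P.Λ * P.K)) * √(P.h N) * √(∫ p in Ioo 0 t ×ˢ Ioo 0 P.Λ, g p.1 p.2 ^ 2) := by
  have hΛ := P.Λ_pos
  have hh := P.h_pos hN
  have hK := P.K_pos
  have hb := P.bdry_pos
  set I := ∫ p in Ioo 0 t ×ˢ Ioo 0 P.Λ, g p.1 p.2 ^ 2
  have hI : 0 ≤ I := integral_nonneg fun _ => sq_nonneg _
  have hE := energy_le hN hlh hl hl₀ ht hgw hg (fun s => nodal P N fun y => lh s y - l s y)
    fun s j => rfl
  simp only [sum_stiffness_eq P hN] at hE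
  set D := ∫ y in (0 : ℝ)..P.Λ, deriv (interp P (nodal P N fun y => lh t y - l t y)) y ^ 2
  have hV0 : MemV P.Λ (fun y => lh 0 y - l 0 y) :=
    ((hlh.memVh 0 le_rfl).memV hN).sub hΛ.le (weak_memV_Icc hl hl₀ ht hgw hg le_rfl)
  have e0 : ∫ y in (0 : ℝ)..P.Λ, deriv (fun y => lh 0 y - l 0 y) y ^ 2 =
      ∫ y in (0 : ℝ)..P.Λ, deriv (fun y => l₀h y - l₀ y) y ^ 2 := by
    rw [intervalIntegral_eq_Ioo hΛ.le, intervalIntegral_eq_Ioo hΛ.le]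
    refine setIntegral_congr_fun measurableSet_Ioo fun y hy => ?_
    have : EqOn (fun y => lh 0 y - l 0 y) (fun y => l₀h y - l₀ y) (Icc 0 P.Λ) := fun z hz => by
      simp only [hlh.init z hz, (hl 1 one_pos).init z hz]
    simp only [deriv_eq_of_eqOn_Icc this hy]
  have h1 := integral_deriv_interp_sq_le P hN hV0
  rw [e0] at h1
  set D₀ := ∫ y in (0 : ℝ)..P.Λ, deriv (fun y => l₀h y - l₀ y) y ^ 2
  set x₀ := nodal P N fun y => lh 0 y - l 0 y
  have h2 := ((interp_memVh P hN x₀).memV hN).sq_apply_zero_le hΛ.le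
  set D₁ := ∫ y in (0 : ℝ)..P.Λ, deriv (interp P x₀) y ^ 2
  have hD₀ : 0 ≤ D₀ := intervalIntegral.integral_nonneg hΛ.le fun _ _ => sq_nonneg _
  have h3 : P.Λ ^ 2 * P.K * D ≤ (P.Λ ^ 2 * P.K + P.bdry * P.Λ) * D₀ +
      3 / 2 * P.h N * P.Λ * I := by
    have h4 : P.bdry * interp P x₀ 0 ^ 2 ≤ P.bdry * (P.Λ * D₀) := by
      refine mul_le_mul_of_nonneg_left (h2.trans ?_) hb.le
      gcongr
    have h5 : P.Λ ^ 2 * P.K * D₁ ≤ P.Λ ^ 2 * P.K * D₀ := by gcongr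
    have h6 : 0 ≤ P.bdry * interp P (nodal P N fun y => lh t y - l t y) 0 ^ 2 := by positivity
    linarith
  have h7 : D ≤ (1 + P.bdry / (P.Λ * P.K)) * D₀ + 3 / (2 * P.Λ * P.K) * P.h N * I := by
    have h8 : (1 + P.bdry / (P.Λ * P.K)) * D₀ + 3 / (2 * P.Λ * P.K) * P.h N * I =
        ((P.Λ ^ 2 * P.K + P.bdry * P.Λ) * D₀ + 3 / 2 * P.h N * P.Λ * I) / (P.Λ ^ 2 * P.K) := by
      field_simp
    rw [h8, le_div_iff₀ (by positivity)]
    linarith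
  refine (Real.sqrt_le_sqrt h7).trans ?_
  have h9 : 0 ≤ P.bdry / (P.Λ * P.K) := by positivity
  rw [← Real.sqrt_mul (by positivity), ← Real.sqrt_mul (by positivity),
    ← Real.sqrt_mul (by positivity)]
  have hadd : ∀ a b : ℝ, 0 ≤ a → 0 ≤ b → √(a + b) ≤ √a + √b := fun a b ha hb =>
    Real.sqrt_le_iff.2 ⟨by positivity, by
      nlinarith [Real.sq_sqrt ha, Real.sq_sqrt hb, mul_nonneg (Real.sqrt_nonneg a) (Real.sqrt_nonneg b)]⟩
  exact hadd _ _ (by positivity) (by positivity)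

lemma normL2_add_le {Λ : ℝ} {u v w : ℝ → ℝ} (hv : MemLp v 2 (volume.restrict (Ioo 0 Λ)))
    (hw : MemLp w 2 (volume.restrict (Ioo 0 Λ)))
    (h : ∀ᵐ y ∂(volume.restrict (Ioo 0 Λ)), u y = v y + w y) :
    normL2 Λ u ≤ normL2 Λ v + normL2 Λ w := by
  unfold normL2
  rw [eLpNorm_congr_ae h]
  exact eLpNorm_add_le hv.1 hw.1 (by norm_num)

lemma normL2_deriv_error_le (hN : 1 ≤ N) (hlh : IsDiscreteSolution P S N l₀h lh)
    (hl₀h : MemVh P N l₀h)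
    (hl : ∀ T : ℝ, 0 < T → IsWeakSolution P S l₀ T l) (hl₀ : MemH1 P.Λ l₀)
    (ht : 0 < t) (hgw : HasWeakDyt P.Λ t l g) :
    normL2 P.Λ (deriv fun y => lh t y - l t y) ≤
      ENNReal.ofReal (P.h N) * normDyy P.Λ (l t) +
        ENNReal.ofReal √(1 + P.bdry / (P.Λ * P.K)) *
          normL2 P.Λ (deriv fun y => l₀h y - l₀ y) +
        ENNReal.ofReal (√(3 / (2 * P.Λ * P.K)) * √(P.h N)) *
          (∫⁻ s in Ioo 0 t, normL2 P.Λ (g s) ^ 2) ^ (1 / 2 : ℝ) := by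
  have hΛ := P.Λ_pos
  have hh := P.h_pos hN
  have hK := P.K_pos
  have hgm : AEStronglyMeasurable (fun p : ℝ × ℝ => g p.1 p.2)
      (volume.restrict (Ioo 0 t ×ˢ Ioo 0 P.Λ)) := hgw.1.aestronglyMeasurable
  -- A representative that is not square integrable makes the right-hand side infinite, its
  -- coefficient being positive.
  by_cases hfin : ∫⁻ s in Ioo 0 t, normL2 P.Λ (g s) ^ 2 = ⊤
  · rw [hfin, ENNReal.top_rpow_of_pos (by norm_num), ENNReal.mul_top, add_top]
    · exact le_top
    · simpa using by positivity
  have hg := memLp_two_of_lintegral_ne_top hgm hfin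
  have hlhV := (hlh.memVh t ht.le).memV hN
  have hlV := weak_memV hl ht
  have hX := (interp_memVh P hN (nodal P N fun y => lh t y - l t y)).memV hN
  have hIl := (interp_memVh P hN (nodal P N (l t))).memV hN
  have hIe := hIl.1.sub hΛ.le hlV.1
  -- Since ℓ_h(t) is its own interpolant, ℓ_h - I_h ℓ is the interpolant of the nodal errors.
  have split : EqOn (fun y => lh t y - l t y) (fun y =>
      interp P (nodal P N fun y => lh t y - l t y) y +
        (interp P (nodal P N (l t)) y - l t y)) (Icc 0 P.Λ) := by
    intro y hy
    have h1 := (hlh.memVh t ht.le).eqOn_interp hN hy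
    have h2 := interp_sub (P := P) (nodal P N (lh t)) (nodal P N (l t)) y
    have h3 : nodal P N (fun y => lh t y - l t y) =
      fun j => nodal P N (lh t) j - nodal P N (l t) j := rfl
    simp only
    rw [h3, h2, ← h1]
    ring
  have hae : ∀ᵐ y ∂(volume.restrict (Ioo 0 P.Λ)), deriv (fun y => lh t y - l t y) y =
      deriv (fun y => interp P (nodal P N (l t)) y - l t y) y +
      deriv (interp P (nodal P N fun y => lh t y - l t y)) y := by
    filter_upwards [ae_deriv_eq_of_eqOn_Icc split, ae_deriv_add hΛ.le hX.1.1 hIe.1] with y h1 h2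
    rw [h1, h2, add_comm]
  refine (normL2_add_le hIe.2 hX.1.2 hae).trans ?_
  rw [add_assoc]
  refine add_le_add (normL2_deriv_sub_interp_le P hN hlV) ?_
  have h0 : MemH1 P.Λ (fun y => l₀h y - l₀ y) := (hl₀h.memV hN).1.sub hΛ.le hl₀
  rw [normL2_eq hΛ.le hX.1.2, normL2_eq hΛ.le h0.2, lintegral_normL2_sq_eq_ofReal hg,
    ENNReal.ofReal_rpow_of_nonneg (integral_nonneg fun _ => sq_nonneg _) (by norm_num),
    ← Real.sqrt_eq_rpow, ← ENNReal.ofReal_mul (by positivity), ← ENNReal.ofReal_mul (by positivity),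
    ← ENNReal.ofReal_add (by positivity) (by positivity)]
  exact ENNReal.ofReal_le_ofReal
    (sqrt_integral_deriv_error_le hN hlh hl hl₀ ht hgw hg)

/-- Solving for y turns the inequality into a lower bound on y, which passes to any infimum,
including the empty one (∞, when no weak mixed derivative exists). -/
lemma le_add_mul_iInf_rpow {ι : Type*} {p : ι → Prop} {J : ι → ℝ≥0∞} {x A B : ℝ≥0∞}
    (hB : B ≠ 0) (hB' : B ≠ ⊤) (h : ∀ i, p i → x ≤ A + B * J i ^ (1 / 2 : ℝ)) :
    x ≤ A + B * (⨅ (i) (_ : p i), J i) ^ (1 / 2 : ℝ) := by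
  have key : ∀ y : ℝ≥0∞, x ≤ A + B * y ^ (1 / 2 : ℝ) ↔ ((x - A) / B) ^ (2 : ℝ) ≤ y := by
    intro y
    rw [← tsub_le_iff_left, ← ENNReal.le_rpow_inv_iff (by norm_num : (0 : ℝ) < 2),
      ENNReal.div_le_iff' hB hB', one_div]
  rw [key]
  exact le_iInf₂ fun i hi => (key _).1 (h i hi)

end ErrorEstimate

end ElasticSwimmer

end

theorem theorem2 (P : ElasticSwimmer.Tail) :
    ∃ C : ℝ, 0 < C ∧
      ∀ (S : ElasticSwimmer.Stroke) (N : ℕ), 1 ≤ N →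
      ∀ (l₀ l₀h : ℝ → ℝ) (l lh : ℝ → ℝ → ℝ),
        ElasticSwimmer.MemH2 P.Λ l₀ →
        ElasticSwimmer.MemVh P N l₀h →
        (∀ T : ℝ, 0 < T → ElasticSwimmer.IsWeakSolution P S l₀ T l) →
        ElasticSwimmer.IsDiscreteSolution P S N l₀h lh →
        ∀ t : ℝ, 0 ≤ t →
          ElasticSwimmer.normL2 P.Λ (deriv fun y => lh t y - l t y) ≤
            ENNReal.ofReal (C * P.h N) *
                (ElasticSwimmer.normDyy P.Λ l₀ + ElasticSwimmer.normDyy P.Λ (l t)) +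
              ENNReal.ofReal C * ElasticSwimmer.normL2 P.Λ (deriv fun y => l₀h y - l₀ y) +
              ENNReal.ofReal (C * Real.sqrt (P.h N)) *
                ElasticSwimmer.intSqDyt P.Λ t l ^ (1 / 2 : ℝ) := by
  have hΛ := P.Λ_pos
  have hK := P.K_pos
  refine ⟨1 + √(1 + P.bdry / (P.Λ * P.K)) + √(3 / (2 * P.Λ * P.K)), by positivity, ?_⟩
  set C := 1 + √(1 + P.bdry / (P.Λ * P.K)) + √(3 / (2 * P.Λ * P.K)) with hC
  have c1 : 0 ≤ √(1 + P.bdry / (P.Λ * P.K)) := Real.sqrt_nonneg _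
  have c2 : 0 ≤ √(3 / (2 * P.Λ * P.K)) := Real.sqrt_nonneg _
  intro S N hN l₀ l₀h l lh hl₀ hl₀h hl hlh t ht
  have hh := P.h_pos hN
  -- At t = 0 the space-time domain is empty; the left-hand side is then the initial error, and C ≥
  -- 1 suffices.
  rcases ht.eq_or_lt with rfl | ht
  · have e : ElasticSwimmer.normL2 P.Λ (deriv fun y => lh 0 y - l 0 y) =
        ElasticSwimmer.normL2 P.Λ (deriv fun y => l₀h y - l₀ y) :=
      eLpNorm_congr_ae (ElasticSwimmer.ae_deriv_eq_of_eqOn_Icc fun y hy => by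
        simp only [hlh.init y hy, (hl 1 one_pos).init y hy])
    rw [e]
    refine le_trans ?_ (le_add_right (le_add_left le_rfl))
    refine le_mul_of_one_le_left zero_le ?_
    rw [ENNReal.one_le_ofReal]
    linarith
  · refine ElasticSwimmer.le_add_mul_iInf_rpow ?_ ENNReal.ofReal_ne_top fun g hg => ?_
    · rw [ne_eq, ENNReal.ofReal_eq_zero, not_le]; positivity
    · refine (ElasticSwimmer.normL2_deriv_error_le hN hlh hl₀h hl hl₀.1 ht hg).trans ?_
      gcongr
      · nlinarith
      · exact le_add_self
      · linarith
      · linarith
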